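/- Let $n\ge 1$ and consider $\min_{x\in\mathcal C} f(x)$, $f=\frac1n\sum_{i=1}^n f_i$, where each $f_i:\mathbb R^d\to\mathbb R$ is convex and $L$-smooth on $\mathbb R^d$ ($L>0$), $\mathcal C\subset\mathbb R^d$ is convex with $\|x-y\|\le D$ for all $x,y\in\mathcal C$, $x^*$ is a minimizer of $f$ over $\mathcal C$, and a linear oracle returns, for every $u\in\mathbb R^d$, a point of $\arg\max_{v\in\mathcal C}\langle u,v\rangle$. CondG$(g,u,y,\gamma,\tau,\eta)$: with $h(x)=\gamma[\langle g,x\rangle+\frac\tau2\|x-y\|^2]+\frac12\|x-u\|^2$, start at $u_1=u$; at $u_t$ obtain $v_t\in\arg\max_{v\in\mathcal C}\langle\nabla h(u_t),u_t-v\rangle$ from one linear oracle call, let $V_t=\langle\nabla h(u_t),u_t-v_t\rangle$, and return $u_t$ if $V_t\le\eta$; otherwise put $u_{t+1}=(1-\beta_t)u_t+\beta_tv_t$ with $\beta_t=\max\{0,\min\{1,V_t/((\gamma\tau+1)\|u_t-v_t\|^2)\}\}$. ARCS (convex case, $\tau=0$): start with $\tilde x^0=x^0\in\mathcal C$. In epoch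 $s=1,2,\dots$ put $\tilde x=\tilde x^{s-1}$, $\tilde g=\frac1n\sum_i g_i(\tilde x)$, $x_0=x^{s-1}$, $\bar x_0=\tilde x$. For $t=1,\dots,T_s$ pick $i_t\in\{1,\dots,n\}$ uniformly and independently, and put $\underline x_t=(1-\alpha_s-p_s)\bar x_{t-1}+\alpha_sx_{t-1}+p_s\tilde x$, $G_t=g_{i_t}(\underline x_t)-g_{i_t}(\tilde x)+\tilde g$, $x_t=\mathrm{CondG}(G_t,x_{t-1},\underline x_t,\gamma_s,0,\eta_{s,t})$, $\bar x_t=(1-\alpha_s-p_s)\bar x_{t-1}+\alpha_sx_t+p_s\tilde x$. Finally $x^s=x_{T_s}$ and $\tilde x^s=\sum_{t=1}^{T_s}\theta_t\bar x_t/\sum_{t=1}^{T_s}\theta_t$. In the first-order case $g_i=\nabla f_i$ (one gradient query per evaluation); in the zeroth-order case $g_i(x)=\sum_{j=1}^d\frac{f_i(x+\mu e_j)-f_i(x-\mu e_j)}{2\mu}e_j$ with $\mu>0$ ($2d$ function queries per evaluation). Parameters: with $s_0=\lfloor\log_2 n\rfloor+1$, $T_s=2^{s-1}$ and $\alpha_s=\frac12$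 for $s\le s_0$, $T_s=2^{s_0-1}$ and $\alpha_s=\frac2{s-s_0+4}$ for $s>s_0$, $p_s=\frac12$, $\gamma_s=\frac1{cL\alpha_s}$, $\eta_{s,t}=\frac{D_0}{sT_sL}$, $\theta_t=\frac{\gamma_s}{\alpha_s}(\alpha_s+p_s)$ for $t<T_s$, $\theta_{T_s}=\frac{\gamma_s}{\alpha_s}$, and $D_0=4(f(x^0)-f(x^*))+cL\|x^0-x^*\|^2$, where $c=3$ in the first-order and $c=5$ in the zeroth-order case. Write $\log^+r=\max\{0,\log r\}$ (with $\log^+0=0$) and $\Lambda=1+\log^+(D_0/\epsilon)$. There is an absolute constant $K>0$, and for all $L,D,D_0$ a constant $M>0$ depending on $L,D,D_0$ only, such that for every $\epsilon>0$ there is a number of epochs $S$, depending only on $n,d,\epsilon,L,D,D_0$, after which, for every such problem, $\tilde x^S\in\mathcal C$ and $\mathbb E[f(\tilde x^S)-f(x^*)]\le\epsilon$, and up to that moment the following bounds hold for every realization of the random indices. (1) First-order case. The number of gradient queries satisfies $N_{GQO}\le K\Lambda\, n\log^+(D_0/\epsilon)$ if $\epsilon\ge D_0/n$, and $N_{GQO}\le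 K\Lambda\,(n\log n+\sqrt{nD_0/\epsilon})$ for every $\epsilon>0$, in particular if $\epsilon<D_0/n$. (2) Zeroth-order case, for all sufficiently small $\mu>0$, that is $0<\mu\le\mu_0(n,d,\epsilon,L,D,D_0)$. The number of function queries satisfies $N_{FQO}\le K\Lambda\, nd\log^+(D_0/\epsilon)$ if $\epsilon\ge D_0/n$, and $N_{FQO}\le K\Lambda\,(nd\log n+d\sqrt{nD_0/\epsilon})$ for every $\epsilon>0$, in particular if $\epsilon<D_0/n$. (3) In both cases the number of linear oracle calls (in the same run) satisfies $N_{LO}\le M\Lambda^2/\epsilon^2$ if $\epsilon\ge D_0/n$, and $N_{LO}\le M\Lambda^2(n^2+n/\epsilon)$ for every $\epsilon>0$, in particular if $\epsilon<D_0/n$. -/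

import Mathlib

open MeasureTheory ProbabilityTheory
open scoped ENNReal

noncomputable section

/-- `ℝ^d` with its Euclidean inner product and norm. -/
abbrev Vec (d : ℕ) : Type := EuclideanSpace ℝ (Fin d)

/-- The data of a finite-sum problem `min_{x ∈ C} (1/n) ∑ i, f i x` together with a linear oracle
for `C`, a starting point and a solution. -/
structure Problem (n d : ℕ) where
  /-- the component functions -/
  f : Fin n → Vec d → ℝ
  /-- the feasible set -/
  C : Set (Vec d)
  /-- the linear oracle -/
  lo : Vec d → Vec d
  /-- the starting point -/
  x₀ : Vec d
  /-- an optimal solution -/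
  xstar : Vec d

/-- `φ` is `L`-smooth on `ℝ^d`. -/
def IsLSmooth {d : ℕ} (L : ℝ) (φ : Vec d → ℝ) : Prop :=
  ContDiff ℝ 1 φ ∧
    ∀ x y : Vec d, |φ y - φ x - inner ℝ (gradient φ x) (y - x)| ≤ L / 2 * ‖y - x‖ ^ 2

namespace Problem

variable {n d : ℕ}

/-- The objective `(1/n) ∑ i, f i x`. -/
def objective (P : Problem n d) (x : Vec d) : ℝ :=
  (n : ℝ)⁻¹ * ∑ i, P.f i x

/-- The assumptions on the problem: convex `L`-smooth components, a convex feasible set of diameter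
at most `D`, an exact linear oracle, a feasible start, and `xstar` a minimizer over `C`. -/
structure Admissible (P : Problem n d) (L D : ℝ) : Prop where
  convex_f : ∀ i, ConvexOn ℝ Set.univ (P.f i)
  smooth_f : ∀ i, IsLSmooth L (P.f i)
  convex_C : Convex ℝ P.C
  diam_C : ∀ x ∈ P.C, ∀ y ∈ P.C, ‖x - y‖ ≤ D
  lo_mem : ∀ u, P.lo u ∈ P.C
  lo_max : ∀ u, ∀ v ∈ P.C, inner ℝ u v ≤ inner ℝ u (P.lo u)
  x₀_mem : P.x₀ ∈ P.C
  xstar_mem : P.xstar ∈ P.C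
  xstar_min : ∀ x ∈ P.C, P.objective P.xstar ≤ P.objective x

end Problem

/-! ### The conditional gradient subroutine CondG -/

section CondG

variable {d : ℕ}

/-- The gradient at `x` of `h(x) = γ (⟨g, x⟩ + (τ / 2) ‖x - y‖²) + (1 / 2) ‖x - u‖²`. -/
def condGGrad (g u y : Vec d) (γ τ : ℝ) (x : Vec d) : Vec d :=
  γ • (g + τ • (x - y)) + (x - u)

/-- The answer of the linear oracle at the iterate `x`: a maximizer over `C` of
`v ↦ ⟨∇h(x), x - v⟩`. -/
def condGVertex (lo : Vec d → Vec d) (g u y : Vec d) (γ τ : ℝ) (x : Vec d) : Vec d :=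
  lo (-condGGrad g u y γ τ x)

/-- `V(x) = max_{v ∈ C} ⟨∇h(x), x - v⟩`, computed with the linear oracle. -/
def condGGap (lo : Vec d → Vec d) (g u y : Vec d) (γ τ : ℝ) (x : Vec d) : ℝ :=
  inner ℝ (condGGrad g u y γ τ x) (x - condGVertex lo g u y γ τ x)

/-- The step size `β` of CondG at the iterate `x`. -/
def condGStep (lo : Vec d → Vec d) (g u y : Vec d) (γ τ : ℝ) (x : Vec d) : ℝ :=
  max 0 (min 1 (condGGap lo g u y γ τ x /
    ((γ * τ + 1) * ‖x - condGVertex lo g u y γ τ x‖ ^ 2)))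

/-- The iterates of CondG (without the stopping test), numbered from `0`. -/
def condGIter (lo : Vec d → Vec d) (g u y : Vec d) (γ τ : ℝ) : ℕ → Vec d
  | 0 => u
  | t + 1 =>
    let x := condGIter lo g u y γ τ t
    let β := condGStep lo g u y γ τ x
    (1 - β) • x + β • condGVertex lo g u y γ τ x

open Classical in
/-- The output of CondG: the first iterate with `V ≤ η` (and `u` if there is none, in which
case `condGCalls` is infinite). -/
def condG (lo : Vec d → Vec d) (g u y : Vec d) (γ τ η : ℝ) : Vec d :=
  if h : ∃ t, condGGap lo g u y γ τ (condGIter lo g u y γ τ t) ≤ η then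
    condGIter lo g u y γ τ (Nat.find h)
  else u

open Classical in
/-- The number of linear oracle calls made by CondG: one for every iterate it visits, the
last one included; `⊤` if it never stops. -/
def condGCalls (lo : Vec d → Vec d) (g u y : Vec d) (γ τ η : ℝ) : ℕ∞ :=
  if h : ∃ t, condGGap lo g u y γ τ (condGIter lo g u y γ τ t) ≤ η then
    ((Nat.find h + 1 : ℕ) : ℕ∞)
  else ⊤

end CondG

/-! ### The ARCS algorithm -/

/-- First-order case (gradient queries), or zeroth-order case (function queries) with smoothing
parameter `μ`. -/
inductive OracleModel where
  | firstOrder : OracleModel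
  | zerothOrder (μ : ℝ) : OracleModel

/-- The coordinate-wise gradient estimator. -/
def coordGrad {d : ℕ} (μ : ℝ) (φ : Vec d → ℝ) (x : Vec d) : Vec d :=
  ∑ j : Fin d,
    ((φ (x + μ • EuclideanSpace.single j (1 : ℝ)) -
        φ (x - μ • EuclideanSpace.single j (1 : ℝ))) / (2 * μ)) •
      EuclideanSpace.single j (1 : ℝ)

namespace OracleModel

/-- The (estimated) gradient of a component function that the algorithm uses. -/
def grad {d : ℕ} : OracleModel → (Vec d → ℝ) → Vec d → Vec d
  | firstOrder, φ, x => gradient φ x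
  | zerothOrder μ, φ, x => coordGrad μ φ x

/-- The number of oracle queries behind one evaluation of `OracleModel.grad` on a component
function: one gradient query, or `2 d` function queries. -/
def queries (d : ℕ) : OracleModel → ℕ
  | firstOrder => 1
  | zerothOrder _ => 2 * d

/-- The numerical constant `3` or `5` in the parameters of the two cases. -/
def const : OracleModel → ℝ
  | firstOrder => 3
  | zerothOrder _ => 5

end OracleModel

/-- The parameters of ARCS; the index `s` is the epoch, `t` the inner iteration. -/
structure ARCSParams where
  τ : ℝ
  T : ℕ → ℕ
  γ : ℕ → ℝ
  α : ℕ → ℝ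
  p : ℕ → ℝ
  θ : ℕ → ℕ → ℝ
  η : ℕ → ℕ → ℝ

/-- State inside an epoch: `x_t`, `\bar x_t`, and the numbers of gradient / function queries and of
linear oracle calls made so far. -/
structure InnerState (d : ℕ) where
  x : Vec d
  xbar : Vec d
  queries : ℕ
  loCalls : ℕ∞

/-- State after an epoch: `x^s`, `\tilde x^s`, and the numbers of gradient / function queries and of
linear oracle calls made so far. -/
structure EpochState (d : ℕ) where
  x : Vec d
  xtilde : Vec d
  queries : ℕ
  loCalls : ℕ∞

section ARCS

variable {n d : ℕ}

/-- The full (estimated) gradient, the average of the `n` component ones. -/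
def fullGrad (P : Problem n d) (o : OracleModel) (x : Vec d) : Vec d :=
  (n : ℝ)⁻¹ • ∑ i, o.grad (P.f i) x

/-- One inner iteration of epoch `s` with sampled index `i`; `xt` is the pivot and `gt` the full
gradient there. -/
def innerStep (P : Problem n d) (o : OracleModel) (A : ARCSParams) (s t : ℕ) (xt gt : Vec d)
    (i : Fin n) (σ : InnerState d) : InnerState d :=
  let xu : Vec d := (1 + A.τ * A.γ s * (1 - A.α s))⁻¹ •
    (((1 + A.τ * A.γ s) * (1 - A.α s - A.p s)) • σ.xbar + A.α s • σ.x +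
      ((1 + A.τ * A.γ s) * A.p s) • xt)
  let G : Vec d := o.grad (P.f i) xu - o.grad (P.f i) xt + gt
  let x' : Vec d := condG P.lo G σ.x xu (A.γ s) A.τ (A.η s t)
  { x := x'
    xbar := (1 - A.α s - A.p s) • σ.xbar + A.α s • x' + A.p s • xt
    queries := σ.queries + 2 * o.queries d
    loCalls := σ.loCalls + condGCalls P.lo G σ.x xu (A.γ s) A.τ (A.η s t) }

/-- The state after `t` inner iterations of epoch `s`, started from `σ`; `ξ t` is the index
sampled in iteration `t` (numbered from `1`). The full gradient costs `n` component gradients. -/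
def innerRun (P : Problem n d) (o : OracleModel) (A : ARCSParams) (s : ℕ) (ξ : ℕ → Fin n)
    (σ : EpochState d) : ℕ → InnerState d
  | 0 => ⟨σ.x, σ.xtilde, σ.queries + n * o.queries d, σ.loCalls⟩
  | t + 1 => innerStep P o A s (t + 1) σ.xtilde (fullGrad P o σ.xtilde) (ξ (t + 1))
      (innerRun P o A s ξ σ t)

/-- Epoch `s` of ARCS. -/
def epoch (P : Problem n d) (o : OracleModel) (A : ARCSParams) (s : ℕ) (ξ : ℕ → Fin n)
    (σ : EpochState d) : EpochState d :=
  let last := innerRun P o A s ξ σ (A.T s)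
  { x := last.x
    xtilde := (∑ t ∈ Finset.Icc 1 (A.T s), A.θ s t)⁻¹ •
      ∑ t ∈ Finset.Icc 1 (A.T s), A.θ s t • (innerRun P o A s ξ σ t).xbar
    queries := last.queries
    loCalls := last.loCalls }

/-- The state of ARCS after `S` epochs; `ξ s t` is the index sampled in iteration `t` of
epoch `s` (both numbered from `1`). -/
def arcs (P : Problem n d) (o : OracleModel) (A : ARCSParams) (ξ : ℕ → ℕ → Fin n) :
    ℕ → EpochState d
  | 0 => ⟨P.x₀, P.x₀, 0, 0⟩
  | s + 1 => epoch P o A (s + 1) (ξ (s + 1)) (arcs P o A ξ s)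

end ARCS

/-! ### The parameters for convex problems -/

/-- `s₀ = ⌊log₂ n⌋ + 1`. -/
def sZero (n : ℕ) : ℕ := Nat.log 2 n + 1

/-- `D₀ = 4 (f(x⁰) - f(x*)) + c L ‖x⁰ - x*‖²` with `c = 3` (first-order) or `c = 5`
(zeroth-order). -/
def Problem.dZero {n d : ℕ} (P : Problem n d) (o : OracleModel) (L : ℝ) : ℝ :=
  4 * (P.objective P.x₀ - P.objective P.xstar) + o.const * L * ‖P.x₀ - P.xstar‖ ^ 2

/-- Epoch lengths. -/
def convexT (n s : ℕ) : ℕ := if s ≤ sZero n then 2 ^ (s - 1) else 2 ^ (sZero n - 1)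

/-- Momentum weights. -/
def convexα (n s : ℕ) : ℝ := if s ≤ sZero n then 1 / 2 else 2 / ((s : ℝ) - sZero n + 4)

/-- Step sizes `γ_s = 1 / (c L α_s)`. -/
def convexγ (n : ℕ) (o : OracleModel) (L : ℝ) (s : ℕ) : ℝ := 1 / (o.const * L * convexα n s)

/-- The parameters of ARCS for convex problems (`τ = 0`). -/
def convexParams (n : ℕ) (o : OracleModel) (L D₀ : ℝ) : ARCSParams where
  τ := 0
  T := convexT n
  γ := convexγ n o L
  α := convexα n
  p := fun _ => 1 / 2
  θ := fun s t =>
    if t < convexT n s then convexγ n o L s / convexα n s * (convexα n s + 1 / 2)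
    else convexγ n o L s / convexα n s
  η := fun s _ => D₀ / (s * convexT n s * L)

/-- ARCS with the parameters for convex problems, after `S` epochs. -/
def convexARCS {n d : ℕ} (P : Problem n d) (o : OracleModel) (L : ℝ) (ξ : ℕ → ℕ → Fin n)
    (S : ℕ) : EpochState d :=
  arcs P o (convexParams n o L (P.dZero o L)) ξ S

/-- The sampled indices are independent and uniform on `{1, …, n}`. -/
structure IsUniformSampling {n : ℕ} {Ω : Type*} [MeasurableSpace Ω] (Pr : Measure Ω)
    (ξ : ℕ → ℕ → Ω → Fin n) : Prop where
  measurable : ∀ s t, Measurable (ξ s t)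
  uniform : ∀ s t i, Pr {ω | ξ s t ω = i} = (n : ℝ≥0∞)⁻¹
  indep : iIndepFun (fun st : ℕ × ℕ => ξ st.1 st.2) Pr

/-- `S` epochs achieve `ε`-accuracy: the output is feasible, and its expected
suboptimality is at most `ε`. -/
def AchievesAccuracy {n d : ℕ} (P : Problem n d) (o : OracleModel) (L : ℝ) {Ω : Type*}
    [MeasurableSpace Ω] (Pr : Measure Ω) (ξ : ℕ → ℕ → Ω → Fin n) (S : ℕ) (ε : ℝ) : Prop :=
  (∀ ω, (convexARCS P o L (fun s t => ξ s t ω) S).xtilde ∈ P.C) ∧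
  Integrable (fun ω => P.objective (convexARCS P o L (fun s t => ξ s t ω) S).xtilde
    - P.objective P.xstar) Pr ∧
  ∫ ω, (P.objective (convexARCS P o L (fun s t => ξ s t ω) S).xtilde
    - P.objective P.xstar) ∂Pr ≤ ε

/-- The logarithmic factor hidden in the soft-O notation, `1 + max 0 (log (D₀ / ε))`. -/
def logFactor (D₀ ε : ℝ) : ℝ := 1 + Real.posLog (D₀ / ε)

end

/-!
The method is analysed epoch by epoch through the potential "weighted suboptimality plus half the
squared distance of the prox point to the solution".

* In one inner iteration (`innerStep_avg_le`) smoothness and the approximate optimality condition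
  returned by CondG give a descent inequality for each sampled index. The error of the gradient
  estimate splits into a centred part and a bias. The centred part vanishes to first order on
  averaging over the index, and its variance is at most `2 L` times a Bregman distance to the pivot
  (co-coercivity), which the pivot weight `1 / 2` absorbs exactly. The bias is zero in the
  first-order case and `O(μ)` in the zeroth-order case, so both cases are treated at once, for an
  arbitrary bias that is small enough for the chosen number of epochs.
* The state of the algorithm depends on finitely many sampled indices, so the expectation over the
  next index is a uniform average (`IsUniformSampling.integral_fresh`) and every function of the
  state is integrable. Summing over an epoch and applying Jensen's inequality gives
  `integral_arcs_succ_le`; the weights before and after an epoch match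
  (`weightBefore_succ_le`), so the epochs telescope. The tolerances of epoch `s` add up to
  `D₀ / (s L)`, hence the rate `D₀ (2 + log S) / rateWeight n S` of `integral_arcs_le`, where the
  harmonic sum of the tolerances accounts for the logarithm.
* CondG is the Frank-Wolfe method with exact line search on a quadratic of curvature `1`; it
  reaches gap `η` after `O(1 + D² / η)` steps (`frankWolfe_gap_steps`), whatever the linear term.
* For `ε ≥ D₀ / 4` the starting point is accurate enough and `S = 0`. Otherwise `S` is the first
  epoch at which the rate falls below `ε`. By minimality the weight at `S` is of the order of
  `(D₀ / ε) log S`, and this two-sided control bounds the sums over the epochs that count queries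
  and linear oracle calls (`exists_epochs`).
-/

noncomputable section

/-! ### Smooth convex functions and gradient estimates -/

section Smooth

variable {d : ℕ} {L : ℝ} {φ : Vec d → ℝ}

lemma IsLSmooth.le_quadratic (h : IsLSmooth L φ) (x y : Vec d) :
    φ y ≤ φ x + inner ℝ (gradient φ x) (y - x) + L / 2 * ‖y - x‖ ^ 2 := by
  have := (abs_le.1 (h.2 x y)).2
  linarith

lemma IsLSmooth.quadratic_le (h : IsLSmooth L φ) (x y : Vec d) :
    φ x + inner ℝ (gradient φ x) (y - x) - L / 2 * ‖y - x‖ ^ 2 ≤ φ y := by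
  have := (abs_le.1 (h.2 x y)).1
  linarith

/-- The first-order convexity inequality. On a segment from `x` the quadratic lower bound and
convexity together bound the defect of the inequality by an arbitrarily small multiple of
`‖y - x‖ ^ 2`. -/
lemma IsLSmooth.inner_gradient_le (hL : 0 < L) (h : IsLSmooth L φ)
    (hc : ConvexOn ℝ Set.univ φ) (x y : Vec d) :
    inner ℝ (gradient φ x) (y - x) ≤ φ y - φ x := by
  by_contra! hlt
  set q : ℝ := L / 2 * ‖y - x‖ ^ 2 with hq
  have hq0 : 0 ≤ q := by positivity
  set a : ℝ := inner ℝ (gradient φ x) (y - x) - (φ y - φ x) with ha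
  set t : ℝ := a / (a + q + 1) with ht
  have hden : 0 < a + q + 1 := by linarith
  have ht0 : 0 < t := by positivity
  have ht1 : t < 1 := by rw [ht, div_lt_one hden]; linarith
  have hta : t * q < a := by
    rw [ht, div_mul_eq_mul_div, div_lt_iff₀ hden]
    nlinarith
  have h1 := hc.2 (Set.mem_univ x) (Set.mem_univ y) (by linarith : 0 ≤ 1 - t) ht0.le (by ring)
  have h2 := h.quadratic_le x ((1 - t) • x + t • y)
  have e : (1 - t) • x + t • y - x = t • (y - x) := by module
  rw [e, inner_smul_right, norm_smul, mul_pow, Real.norm_eq_abs, sq_abs] at h2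
  simp only [smul_eq_mul] at h1
  have h3 : t * a ≤ t * (t * q) := by
    rw [ha, hq]; nlinarith
  have := le_of_mul_le_mul_left h3 ht0
  linarith

/-- Co-coercivity of the gradient, from one gradient step at `y` for
`z ↦ φ z - ⟪∇φ x, z⟫`, which is minimized at `x`. -/
lemma IsLSmooth.norm_gradient_sub_sq_le (hL : 0 < L) (h : IsLSmooth L φ)
    (hc : ConvexOn ℝ Set.univ φ) (x y : Vec d) :
    ‖gradient φ y - gradient φ x‖ ^ 2 ≤
      2 * L * (φ y - φ x - inner ℝ (gradient φ x) (y - x)) := by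
  set w := gradient φ y - gradient φ x with hw
  have h1 := h.le_quadratic y (y - L⁻¹ • w)
  have h2 := h.inner_gradient_le hL hc x (y - L⁻¹ • w)
  have e1 : y - L⁻¹ • w - y = -(L⁻¹ • w) := by abel
  have e2 : y - L⁻¹ • w - x = (y - x) - L⁻¹ • w := by abel
  rw [e1, inner_neg_right, inner_smul_right, norm_neg, norm_smul, mul_pow, Real.norm_eq_abs,
    sq_abs] at h1
  rw [e2, inner_sub_right, inner_smul_right] at h2
  have h3 : inner ℝ (gradient φ y) w - inner ℝ (gradient φ x) w = ‖w‖ ^ 2 := by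
    rw [← inner_sub_left, ← hw, real_inner_self_eq_norm_sq]
  have h4 : L / 2 * (L⁻¹ ^ 2 * ‖w‖ ^ 2) = L⁻¹ * ‖w‖ ^ 2 / 2 := by field_simp
  have h5 : L⁻¹ * inner ℝ (gradient φ y) w - L⁻¹ * inner ℝ (gradient φ x) w =
      L⁻¹ * ‖w‖ ^ 2 := by rw [← mul_sub, h3]
  have h6 : L⁻¹ * ‖w‖ ^ 2 ≤ 2 * (φ y - φ x - inner ℝ (gradient φ x) (y - x)) := by linarith
  have h7 := mul_le_mul_of_nonneg_left h6 hL.le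
  rw [mul_inv_cancel_left₀ hL.ne'] at h7
  linarith

/-- The coordinate-wise estimator differs from the gradient by `O(μ)`: by smoothness every
symmetric difference quotient is within `L μ / 2` of the partial derivative. -/
lemma IsLSmooth.norm_coordGrad_sub_gradient_le (h : IsLSmooth L φ) {μ : ℝ} (hμ : 0 < μ)
    (x : Vec d) : ‖coordGrad μ φ x - gradient φ x‖ ≤ d * (L * μ / 2) := by
  have hg : gradient φ x =
      ∑ j : Fin d, inner ℝ (gradient φ x) (EuclideanSpace.single j (1 : ℝ)) •
        EuclideanSpace.single j (1 : ℝ) := by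
    generalize gradient φ x = g
    ext k
    simp [EuclideanSpace.inner_single_right, Finset.sum_apply, Pi.single_apply]
  have hsum : coordGrad μ φ x - gradient φ x = ∑ j : Fin d,
      ((φ (x + μ • EuclideanSpace.single j (1 : ℝ)) -
        φ (x - μ • EuclideanSpace.single j (1 : ℝ))) / (2 * μ) -
        inner ℝ (gradient φ x) (EuclideanSpace.single j (1 : ℝ))) •
      EuclideanSpace.single j (1 : ℝ) := by
    conv_lhs => rw [hg]
    simp only [coordGrad, sub_smul, Finset.sum_sub_distrib]
  rw [hsum]
  refine (norm_sum_le _ _).trans ?_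
  refine (Finset.sum_le_card_nsmul _ _ (L * μ / 2) fun j _ => ?_).trans (by simp)
  set e : Vec d := EuclideanSpace.single j (1 : ℝ) with he
  have hn : ‖e‖ = 1 := by simp [he]
  rw [norm_smul, hn, mul_one, Real.norm_eq_abs]
  have a1 := h.2 x (x + μ • e)
  have a2 := h.2 x (x - μ • e)
  have e1 : x + μ • e - x = μ • e := by abel
  have e2 : x - μ • e - x = -(μ • e) := by abel
  rw [e1, inner_smul_right, norm_smul, hn, Real.norm_eq_abs, mul_one, sq_abs, abs_le] at a1
  rw [e2, inner_neg_right, inner_smul_right, norm_neg, norm_smul, hn, Real.norm_eq_abs,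
    mul_one, sq_abs, abs_le] at a2
  have key : ∀ a b : ℝ, |a - 2 * μ * b| ≤ L * μ ^ 2 → |a / (2 * μ) - b| ≤ L * μ / 2 := by
    intro a b hab
    have : a / (2 * μ) - b = (a - 2 * μ * b) / (2 * μ) := by field_simp
    rw [this, abs_div, abs_of_pos (by positivity : 0 < 2 * μ), div_le_iff₀ (by positivity)]
    linarith
  apply key
  rw [abs_le]
  constructor <;> linarith [a1.1, a1.2, a2.1, a2.2]

end Smooth

/-! ### Complexity of the conditional gradient subroutine -/

section CondGAnalysis

/-- The clipped step is an exact line search: it minimizes `b ↦ -b V + b² q / 2` on `[0, 1]`.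
For `q = 0` the quotient is a junk `0`, which is harmless since then `V = 0`. -/
lemma clipped_step_le {V q b : ℝ} (hV : 0 ≤ V) (hq : 0 ≤ q) (h0 : q = 0 → V = 0)
    (hb1 : b ≤ 1) :
    -(max 0 (min 1 (V / q)) * V) + max 0 (min 1 (V / q)) ^ 2 * q / 2 ≤
      -(b * V) + b ^ 2 * q / 2 := by
  rcases hq.eq_or_lt with hq | hq
  · simp [h0 hq.symm, ← hq]
  · rcases le_total q V with h | h
    · have : 1 ≤ V / q := by rwa [one_le_div hq]
      rw [min_eq_left this, max_eq_right zero_le_one]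
      nlinarith [mul_nonneg (sub_nonneg.2 hb1) (sub_nonneg.2 h), mul_nonneg hq.le
        (sq_nonneg (1 - b))]
    · have h1 : V / q ≤ 1 := by rwa [div_le_one hq]
      rw [min_eq_right h1, max_eq_right (by positivity)]
      have e : -(V / q * V) + (V / q) ^ 2 * q / 2 = -(V ^ 2 / q) / 2 := by field_simp; ring
      have e2 : -(b * V) + b ^ 2 * q / 2 + V ^ 2 / q / 2 = (b * q - V) ^ 2 / (2 * q) := by
        field_simp; ring
      have : 0 ≤ (b * q - V) ^ 2 / (2 * q) := by positivity
      linarith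

/-- The Frank-Wolfe primal rate: the suboptimality is at most `2 A / (t + 1)`. -/
lemma frankWolfe_rate {A : ℝ} (hA : 0 < A) {δ V : ℕ → ℝ} {K : ℕ} (hδV : ∀ t < K, δ t ≤ V t)
    (hstep : ∀ t < K, ∀ b : ℝ, 0 ≤ b → b ≤ 1 → δ (t + 1) ≤ δ t - b * V t + b ^ 2 * A / 2)
    {t : ℕ} (ht : t + 1 ≤ K) : δ (t + 1) ≤ 2 * A / (t + 2) := by
  induction t with
  | zero =>
    have h1 := hstep 0 ht 1 zero_le_one le_rfl
    have h2 := hδV 0 ht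
    norm_num at h1 ⊢
    linarith
  | succ t ih =>
    have h0 := ih (by omega)
    have hd := hδV (t + 1) ht
    have hs := hstep (t + 1) ht (2 / (t + 3)) (by positivity)
      (by rw [div_le_one (by positivity)]; linarith [(Nat.cast_nonneg t : (0 : ℝ) ≤ t)])
    have hb : (2 / ((t : ℝ) + 3)) * δ (t + 1) ≤ 2 / (t + 3) * V (t + 1) := by gcongr
    have h4 : (1 - 2 / ((t : ℝ) + 3)) * δ (t + 1) ≤
        (1 - 2 / ((t : ℝ) + 3)) * (2 * A / (t + 2)) := by
      refine mul_le_mul_of_nonneg_left h0 ?_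
      rw [sub_nonneg, div_le_one (by positivity)]; linarith [(Nat.cast_nonneg t : (0 : ℝ) ≤ t)]
    have h5 : 2 * A / ((t : ℝ) + 3) - ((1 - 2 / ((t : ℝ) + 3)) * (2 * A / (t + 2)) +
        (2 / ((t : ℝ) + 3)) ^ 2 * A / 2) = 2 * A / ((t + 2) * (t + 3) ^ 2) := by
      field_simp; ring
    have h6 : 0 ≤ 2 * A / (((t : ℝ) + 2) * (t + 3) ^ 2) := by positivity
    push_cast
    have e : (t : ℝ) + 1 + 2 = t + 3 := by ring
    rw [e]
    nlinarith

/-- If the Frank-Wolfe gap stays above `η` during `2 N` steps, then `N = O(1 + A / η)`: after `N`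
steps the suboptimality is `O(A / N)`, and the next `N` steps each decrease it by an amount of
order `min 1 (η / A) * η`. -/
lemma frankWolfe_gap_steps {A η : ℝ} (hA : 0 < A) (hη : 0 < η) {δ V : ℕ → ℝ} {N : ℕ}
    (hδV : ∀ t < 2 * N, δ t ≤ V t)
    (hstep : ∀ t < 2 * N, ∀ b : ℝ, 0 ≤ b → b ≤ 1 → δ (t + 1) ≤ δ t - b * V t + b ^ 2 * A / 2)
    (hlast : 0 ≤ δ (2 * N)) (hgap : ∀ t < 2 * N, η < V t) : (N : ℝ) ≤ 1 + 2 * (A / η) := by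
  rcases Nat.eq_zero_or_pos N with rfl | hN
  · have : 0 < A / η := by positivity
    norm_num; linarith
  set b : ℝ := min 1 (η / A) with hb
  have hb0 : 0 < b := lt_min one_pos (by positivity)
  have hb1 : b ≤ 1 := min_le_left _ _
  have hbA : b * A ≤ η := by
    have : b ≤ η / A := min_le_right _ _
    rwa [le_div_iff₀ hA] at this
  have hdec : ∀ j : ℕ, j ≤ N → δ (N + j) ≤ δ N - j * (b * η / 2) := by
    intro j
    induction j with
    | zero => intro _; simp
    | succ j ih =>
      intro hj
      have h1 := ih (by omega)
      have h2 := hstep (N + j) (by omega) b hb0.le hb1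
      have h3 := hgap (N + j) (by omega)
      have h4 : b * η ≤ b * V (N + j) := by gcongr
      have h5 : b ^ 2 * A ≤ b * η := by rw [pow_two, mul_assoc]; gcongr
      have h6 : N + (j + 1) = N + j + 1 := by ring
      rw [h6]; push_cast; linarith
  have h1 := hdec N le_rfl
  rw [← two_mul] at h1
  obtain ⟨k, rfl⟩ : ∃ k, N = k + 1 := ⟨N - 1, by omega⟩
  have h2 := frankWolfe_rate hA hδV hstep (t := k) (by omega)
  push_cast at h1 h2 ⊢
  set y := A / η with hy
  have hy0 : 0 < y := by positivity
  have h3 : ((k : ℝ) + 1) * (b * η / 2) * (k + 2) ≤ 2 * A := by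
    rw [← le_div_iff₀ (by positivity)]; linarith
  have hA' : A = y * η := by rw [hy]; field_simp
  have h4 : ((k : ℝ) + 1) * b * (k + 2) ≤ 4 * y := by
    rw [hA'] at h3
    have : (((k : ℝ) + 1) * b * (k + 2)) * η ≤ (4 * y) * η := by nlinarith
    exact le_of_mul_le_mul_right this hη
  have hηA : η / A = 1 / y := by rw [hA']; field_simp
  by_contra! hcon
  rcases le_total 1 y with h | h
  · have hb' : b = 1 / y := by
      rw [hb, hηA]; exact min_eq_right (by rw [div_le_one hy0]; exact h)
    rw [hb'] at h4
    have h5 : ((k : ℝ) + 1) * (k + 2) ≤ 4 * y * y := by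
      have e : ((k : ℝ) + 1) * (1 / y) * (k + 2) = ((k : ℝ) + 1) * (k + 2) / y := by ring
      rwa [e, div_le_iff₀ hy0] at h4
    nlinarith
  · have hb' : b = 1 := by
      rw [hb, hηA]; exact min_eq_left (by rw [one_le_div hy0]; exact h)
    rw [hb'] at h4
    nlinarith

variable {d : ℕ} {lo : Vec d → Vec d} {C : Set (Vec d)} {A γ η : ℝ} {g u y : Vec d}

lemma condGGrad_zero (g u y : Vec d) (γ : ℝ) (x : Vec d) :
    condGGrad g u y γ 0 x = γ • g + (x - u) := by
  simp [condGGrad]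

lemma inner_condGGrad_le_gap (hmax : ∀ u, ∀ v ∈ C, inner ℝ u v ≤ inner ℝ u (lo u))
    (x : Vec d) {v : Vec d} (hv : v ∈ C) :
    inner ℝ (condGGrad g u y γ 0 x) (x - v) ≤ condGGap lo g u y γ 0 x := by
  have h := hmax (-condGGrad g u y γ 0 x) v hv
  rw [condGGap, condGVertex, inner_sub_right, inner_sub_right]
  simp only [inner_neg_left] at h ⊢
  linarith

lemma condGIter_mem (hC : Convex ℝ C) (hlo : ∀ u, lo u ∈ C) (hu : u ∈ C) (t : ℕ) :
    condGIter lo g u y γ 0 t ∈ C := by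
  induction t with
  | zero => exact hu
  | succ t ih =>
    refine hC ih (hlo _) ?_ ?_ (by ring)
    · exact sub_nonneg.2 (max_le zero_le_one (min_le_left _ _))
    · exact le_max_left _ _

/-- The exact second-order expansion of the quadratic model minimized by CondG. -/
lemma condG_model_expand (g u y : Vec d) (γ : ℝ) (x w : Vec d) :
    γ * inner ℝ g w + ‖w - u‖ ^ 2 / 2 = γ * inner ℝ g x + ‖x - u‖ ^ 2 / 2 +
      inner ℝ (condGGrad g u y γ 0 x) (w - x) + ‖w - x‖ ^ 2 / 2 := by
  rw [condGGrad_zero]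
  have e : w - u = (w - x) + (x - u) := by abel
  rw [e, norm_add_sq_real, inner_add_left, inner_smul_left, inner_sub_right (x := g),
    real_inner_comm (x - u) (w - x)]
  simp only [conj_trivial]
  ring

/-- CondG stops after `O(1 + A / η)` linear oracle calls, `A` a bound for the squared diameter. -/
lemma exists_condGGap_le (hC : Convex ℝ C) (hlo : ∀ u, lo u ∈ C)
    (hmax : ∀ u, ∀ v ∈ C, inner ℝ u v ≤ inner ℝ u (lo u)) (hA : 0 < A)
    (hdiam : ∀ x ∈ C, ∀ z ∈ C, ‖x - z‖ ^ 2 ≤ A) (hη : 0 < η) (hu : u ∈ C) :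
    ∃ t : ℕ, condGGap lo g u y γ 0 (condGIter lo g u y γ 0 t) ≤ η ∧
      (t : ℝ) + 1 ≤ 4 + 4 * (A / η) := by
  set N : ℕ := ⌊1 + 2 * (A / η)⌋₊ + 1 with hN
  have hN1 : 1 + 2 * (A / η) < N := by rw [hN]; push_cast; exact Nat.lt_floor_add_one _
  have hN2 : (N : ℝ) ≤ 2 + 2 * (A / η) := by
    have := Nat.floor_le (by positivity : 0 ≤ 1 + 2 * (A / η))
    rw [hN]; push_cast; linarith
  by_contra! hcon
  set X : ℕ → Vec d := condGIter lo g u y γ 0 with hX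
  have hXC : ∀ t, X t ∈ C := condGIter_mem hC hlo hu
  set m : Vec d → ℝ := fun w => γ * inner ℝ g w + ‖w - u‖ ^ 2 / 2 with hm
  have hexp : ∀ x w, m w = m x + inner ℝ (condGGrad g u y γ 0 x) (w - x) + ‖w - x‖ ^ 2 / 2 :=
    fun x w => condG_model_expand g u y γ x w
  have hgap : ∀ t < 2 * N, η < condGGap lo g u y γ 0 (X t) := by
    intro t ht
    by_contra! h
    have h1 := hcon t h
    have : (t : ℝ) + 1 ≤ 2 * N := by exact_mod_cast ht
    linarith
  -- the suboptimality is measured against the last iterate, so no minimizer has to exist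
  have := frankWolfe_gap_steps (N := N) hA hη (δ := fun t => m (X t) - m (X (2 * N)))
    (V := fun t => condGGap lo g u y γ 0 (X t)) ?_ ?_ (by simp) hgap
  · linarith
  · intro t _
    have h1 := hexp (X t) (X (2 * N))
    have h2 := inner_condGGrad_le_gap (g := g) (u := u) (y := y) (γ := γ) hmax (X t) (hXC (2 * N))
    have h3 : inner ℝ (condGGrad g u y γ 0 (X t)) (X t - X (2 * N)) =
      - inner ℝ (condGGrad g u y γ 0 (X t)) (X (2 * N) - X t) := by
      rw [← inner_neg_right, neg_sub]
    have h4 : 0 ≤ ‖X (2 * N) - X t‖ ^ 2 := by positivity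
    linarith
  · intro t _ b hb0 hb1
    set v := condGVertex lo g u y γ 0 (X t) with hv
    set β := condGStep lo g u y γ 0 (X t) with hβ
    set V := condGGap lo g u y γ 0 (X t) with hV
    have hvC : v ∈ C := hlo _
    have hVdef : inner ℝ (condGGrad g u y γ 0 (X t)) (v - X t) = -V := by
      rw [hV, condGGap, ← inner_neg_right, neg_sub]
    have hV0 : 0 ≤ V := by
      have := inner_condGGrad_le_gap (g := g) (u := u) (y := y) (γ := γ) hmax (X t) (hXC t)
      simpa using this
    have hnext : X (t + 1) - X t = β • (v - X t) := by
      have : X (t + 1) = (1 - β) • X t + β • v := rfl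
      rw [this]; module
    have h1 := hexp (X t) (X (t + 1))
    rw [hnext, inner_smul_right, norm_smul, mul_pow, Real.norm_eq_abs, sq_abs, hVdef,
      norm_sub_rev v] at h1
    have hβdef : β = max 0 (min 1 (V / ‖X t - v‖ ^ 2)) := by
      rw [hβ, condGStep]; simp [hV, hv]
    have h2 := clipped_step_le (V := V) (q := ‖X t - v‖ ^ 2) hV0 (by positivity) (by
      intro h0
      have hxv : X t - v = 0 := by simpa using h0
      rw [hV, condGGap, ← hv, hxv, inner_zero_right]) hb1
    rw [← hβdef] at h2
    have h3 : b ^ 2 * ‖X t - v‖ ^ 2 ≤ b ^ 2 * A := by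
      gcongr; exact hdiam _ (hXC t) _ hvC
    linarith

/-- The output of CondG is an `η`-approximate solution, over `C`, of the variational inequality for
the minimizer of its quadratic model. -/
lemma condG_spec (hC : Convex ℝ C) (hlo : ∀ u, lo u ∈ C)
    (hmax : ∀ u, ∀ v ∈ C, inner ℝ u v ≤ inner ℝ u (lo u)) (hA : 0 < A)
    (hdiam : ∀ x ∈ C, ∀ z ∈ C, ‖x - z‖ ^ 2 ≤ A) (hη : 0 < η) (hu : u ∈ C) :
    condG lo g u y γ 0 η ∈ C ∧
    ∀ v ∈ C, inner ℝ (γ • g + (condG lo g u y γ 0 η - u)) (condG lo g u y γ 0 η - v) ≤ η := by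
  classical
  obtain ⟨t, ht, -⟩ := exists_condGGap_le (g := g) (y := y) (γ := γ) hC hlo hmax hA hdiam hη hu
  have h : ∃ t, condGGap lo g u y γ 0 (condGIter lo g u y γ 0 t) ≤ η := ⟨t, ht⟩
  have e : condG lo g u y γ 0 η = condGIter lo g u y γ 0 (Nat.find h) := by
    rw [condG, dif_pos h]
  rw [e]
  refine ⟨condGIter_mem hC hlo hu _, fun v hv => ?_⟩
  rw [← condGGrad_zero (y := y)]
  exact (inner_condGGrad_le_gap hmax _ hv).trans (Nat.find_spec h)

lemma condGCalls_le (hC : Convex ℝ C) (hlo : ∀ u, lo u ∈ C)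
    (hmax : ∀ u, ∀ v ∈ C, inner ℝ u v ≤ inner ℝ u (lo u)) (hA : 0 < A)
    (hdiam : ∀ x ∈ C, ∀ z ∈ C, ‖x - z‖ ^ 2 ≤ A) (hη : 0 < η) (hu : u ∈ C) :
    ∃ c : ℕ, condGCalls lo g u y γ 0 η = c ∧ (c : ℝ) ≤ 4 + 4 * (A / η) := by
  classical
  obtain ⟨t, ht, hle⟩ := exists_condGGap_le (g := g) (y := y) (γ := γ) hC hlo hmax hA hdiam hη hu
  have h : ∃ t, condGGap lo g u y γ 0 (condGIter lo g u y γ 0 t) ≤ η := ⟨t, ht⟩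
  refine ⟨Nat.find h + 1, ?_, ?_⟩
  · rw [condGCalls, dif_pos h]
  · have : ((Nat.find h : ℕ) : ℝ) ≤ t := by exact_mod_cast Nat.find_min' h ht
    push_cast
    linarith

end CondGAnalysis

/-! ### One inner iteration in conditional mean -/

section OneStep

variable {n d : ℕ}

/-- The progress of one inner iteration for a fixed sampled index. `G = gu + δ + e` is the gradient
estimate, with `δ` its centred error and `e` its bias; the term linear in `δ` vanishes on
averaging. -/
lemma inner_step_pointwise {F : Vec d → ℝ} {L D ρ c α γ η : ℝ}
    {gu xu xbar z xt xp xs G δ e : Vec d} (hL : 0 < L) (hα : 0 < α) (hα2 : α ≤ 1 / 2) (hc : 3 ≤ c)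
    (hγ : γ = 1 / (c * L * α))
    (hup : ∀ y, F y ≤ F xu + inner ℝ gu (y - xu) + L / 2 * ‖y - xu‖ ^ 2)
    (hlow : ∀ y, F xu + inner ℝ gu (y - xu) ≤ F y)
    (hxu : xu = (1 - α - 1 / 2) • xbar + α • z + (1 / 2 : ℝ) • xt)
    (hcg : inner ℝ (γ • G + (xp - z)) (xp - xs) ≤ η) (hG : G = gu + δ + e) (he : ‖e‖ ≤ ρ)
    (hD : ‖xp - xs‖ ≤ D) :
    F ((1 - α - 1 / 2) • xbar + α • xp + (1 / 2 : ℝ) • xt) ≤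
      (1 - α - 1 / 2) * F xbar + α * F xs + 1 / 2 * (F xu + inner ℝ gu (xt - xu)) +
      α / γ * (η + ‖z - xs‖ ^ 2 / 2 - ‖xp - xs‖ ^ 2 / 2) + ‖δ‖ ^ 2 / (4 * L) -
      α * inner ℝ δ (z - xs) + α * (ρ * D) := by
  have hγ0 : 0 < γ := by rw [hγ]; positivity
  set w := xp - z with hw
  set xb := (1 - α - 1 / 2) • xbar + α • xp + (1 / 2 : ℝ) • xt with hxb
  have e1 : xb - xu = α • w := by rw [hxb, hxu, hw]; module
  have e2 : xb - xu = (1 - α - 1 / 2) • (xbar - xu) + α • (xs - xu) + α • (xp - xs) +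
      (1 / 2 : ℝ) • (xt - xu) := by rw [hxb]; module
  have h1 := hup xb
  have h1n : ‖xb - xu‖ ^ 2 = α ^ 2 * ‖w‖ ^ 2 := by
    rw [e1, norm_smul, mul_pow, Real.norm_eq_abs, sq_abs]
  rw [h1n, e2, inner_add_right, inner_add_right, inner_add_right, inner_smul_right,
    inner_smul_right, inner_smul_right, inner_smul_right] at h1
  have h2 : inner ℝ gu (xp - xs) = inner ℝ G (xp - xs) - inner ℝ δ w - inner ℝ δ (z - xs) -
      inner ℝ e (xp - xs) := by
    have : inner ℝ δ (xp - xs) = inner ℝ δ w + inner ℝ δ (z - xs) := by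
      rw [← inner_add_right, hw]; congr 1; abel
    rw [hG, inner_add_left, inner_add_left, this]; ring
  have h3 : inner ℝ w (xp - xs) = (‖w‖ ^ 2 + ‖xp - xs‖ ^ 2 - ‖z - xs‖ ^ 2) / 2 := by
    have : z - xs = (xp - xs) - w := by rw [hw]; abel
    rw [this, norm_sub_sq_real (xp - xs) w, real_inner_comm]; ring
  have h4 : γ * inner ℝ G (xp - xs) ≤ η - inner ℝ w (xp - xs) := by
    rw [inner_add_left, inner_smul_left] at hcg
    simp only [conj_trivial] at hcg
    linarith
  have h5 : α * inner ℝ G (xp - xs) ≤ α / γ * (η - inner ℝ w (xp - xs)) := by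
    have := mul_le_mul_of_nonneg_left h4 (by positivity : 0 ≤ α / γ)
    have e : α / γ * (γ * inner ℝ G (xp - xs)) = α * inner ℝ G (xp - xs) := by field_simp
    linarith
  have hαγ : α / γ = c * L * α ^ 2 := by rw [hγ]; field_simp
  -- the weight in Young's inequality is the one for which `c ≥ 3` cancels all terms in `‖w‖ ^ 2`
  have h6 : -(α * inner ℝ δ w) ≤ ‖δ‖ ^ 2 / (4 * L) + L * α ^ 2 * ‖w‖ ^ 2 := by
    have a1 : -inner ℝ δ w ≤ ‖δ‖ * ‖w‖ := by
      have := neg_le_of_abs_le (abs_real_inner_le_norm δ w); linarith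
    have a2 : α * -inner ℝ δ w ≤ α * (‖δ‖ * ‖w‖) := mul_le_mul_of_nonneg_left a1 hα.le
    have a3 : ‖δ‖ ^ 2 / (4 * L) + L * α ^ 2 * ‖w‖ ^ 2 - α * (‖δ‖ * ‖w‖) =
        (‖δ‖ - 2 * L * α * ‖w‖) ^ 2 / (4 * L) := by field_simp; ring
    have a4 : 0 ≤ (‖δ‖ - 2 * L * α * ‖w‖) ^ 2 / (4 * L) := by positivity
    linarith
  have h7 : -(α * inner ℝ e (xp - xs)) ≤ α * (ρ * D) := by
    have a1 : -inner ℝ e (xp - xs) ≤ ‖e‖ * ‖xp - xs‖ := by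
      have := neg_le_of_abs_le (abs_real_inner_le_norm e (xp - xs)); linarith
    have a2 : ‖e‖ * ‖xp - xs‖ ≤ ρ * D :=
      mul_le_mul he hD (norm_nonneg _) ((norm_nonneg _).trans he)
    have := mul_le_mul_of_nonneg_left (a1.trans a2) hα.le
    linarith
  have h8 := mul_le_mul_of_nonneg_left (hlow xbar) (by linarith : 0 ≤ 1 - α - 1 / 2)
  have h9 := mul_le_mul_of_nonneg_left (hlow xs) hα.le
  have h10 : L / 2 * (α ^ 2 * ‖w‖ ^ 2) + L * α ^ 2 * ‖w‖ ^ 2 ≤ α / γ * (‖w‖ ^ 2 / 2) := by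
    rw [hαγ]
    have : 0 ≤ (c - 3) * (L * α ^ 2 * ‖w‖ ^ 2) := mul_nonneg (by linarith) (by positivity)
    linarith
  rw [h2] at h1
  rw [h3] at h5
  linarith

lemma avg_norm_sub_avg_sq_le (hn : 0 < n) (w : Fin n → Vec d) :
    (n : ℝ)⁻¹ * ∑ i, ‖w i - (n : ℝ)⁻¹ • ∑ j, w j‖ ^ 2 ≤ (n : ℝ)⁻¹ * ∑ i, ‖w i‖ ^ 2 := by
  set m := (n : ℝ)⁻¹ • ∑ j, w j with hm
  have hn0 : (n : ℝ) ≠ 0 := by positivity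
  have hsum : ∑ j, w j = (n : ℝ) • m := by rw [hm, smul_smul, mul_inv_cancel₀ hn0, one_smul]
  have : ∑ i, ‖w i - m‖ ^ 2 = ∑ i, ‖w i‖ ^ 2 - n * ‖m‖ ^ 2 := by
    simp only [norm_sub_sq_real, Finset.sum_add_distrib, Finset.sum_sub_distrib]
    rw [← Finset.mul_sum, ← sum_inner, hsum, inner_smul_left, real_inner_self_eq_norm_sq]
    simp
    ring
  rw [this]
  gcongr
  have : 0 ≤ (n : ℝ) * ‖m‖ ^ 2 := by positivity
  linarith

lemma sum_sub_avg_eq_zero (hn : 0 < n) (w : Fin n → Vec d) :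
    ∑ i, (w i - (n : ℝ)⁻¹ • ∑ j, w j) = 0 := by
  have hn0 : (n : ℝ) ≠ 0 := by positivity
  rw [Finset.sum_sub_distrib, Finset.sum_const, Finset.card_univ, Fintype.card_fin,
    ← Nat.cast_smul_eq_nsmul ℝ, smul_smul, mul_inv_cancel₀ hn0, one_smul, sub_self]

/-- A uniform bound for the error of the gradient estimates on the components of the problem. -/
def GradErrorLE (P : Problem n d) (o : OracleModel) (b : ℝ) : Prop :=
  ∀ i x, ‖o.grad (P.f i) x - gradient (P.f i) x‖ ≤ b

variable {P : Problem n d} {o : OracleModel} {L D b : ℝ}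

lemma avg_gradient_inner (x v : Vec d) :
    inner ℝ (fullGrad P .firstOrder x) v =
      (n : ℝ)⁻¹ * ∑ i, inner ℝ (gradient (P.f i) x) v := by
  simp [fullGrad, OracleModel.grad, inner_smul_left, sum_inner]

lemma avg_const (hn : 0 < n) (a : ℝ) : (n : ℝ)⁻¹ * ∑ _i : Fin n, a = a := by
  have hn0 : (n : ℝ) ≠ 0 := by positivity
  simp [hn0]

lemma avg_const_add_sub (hn : 0 < n) (K : ℝ) (a a' : Fin n → ℝ) :
    (n : ℝ)⁻¹ * ∑ i, (K + a i - a' i) =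
      K + (n : ℝ)⁻¹ * ∑ i, a i - (n : ℝ)⁻¹ * ∑ i, a' i := by
  rw [Finset.sum_sub_distrib, Finset.sum_add_distrib, mul_sub, mul_add, avg_const hn]

lemma Problem.Admissible.objective_le_quadratic (hP : P.Admissible L D) (hn : 0 < n)
    (x y : Vec d) : P.objective y ≤ P.objective x + inner ℝ (fullGrad P .firstOrder x) (y - x) +
      L / 2 * ‖y - x‖ ^ 2 := by
  rw [avg_gradient_inner, ← avg_const hn (L / 2 * ‖y - x‖ ^ 2), Problem.objective,
    Problem.objective, ← mul_add, ← mul_add, ← Finset.sum_add_distrib, ← Finset.sum_add_distrib]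
  gcongr with i
  exact (hP.smooth_f i).le_quadratic x y

lemma Problem.Admissible.le_objective (hP : P.Admissible L D) (hL : 0 < L)
    (x y : Vec d) : P.objective x + inner ℝ (fullGrad P .firstOrder x) (y - x) ≤
      P.objective y := by
  rw [avg_gradient_inner, Problem.objective, Problem.objective, ← mul_add,
    ← Finset.sum_add_distrib]
  gcongr with i
  have := (hP.smooth_f i).inner_gradient_le hL (hP.convex_f i) x y
  linarith

/-- The variance of the exact variance-reduced gradient estimate is controlled by the Bregman
distance from the evaluation point to the pivot. -/
lemma Problem.Admissible.avg_norm_centred_sq_le (hP : P.Admissible L D) (hL : 0 < L) (hn : 0 < n)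
    (x y : Vec d) :
    (n : ℝ)⁻¹ * ∑ i, ‖gradient (P.f i) x - gradient (P.f i) y -
        (fullGrad P .firstOrder x - fullGrad P .firstOrder y)‖ ^ 2 ≤
      2 * L * (P.objective y - P.objective x - inner ℝ (fullGrad P .firstOrder x) (y - x)) := by
  have h1 := avg_norm_sub_avg_sq_le hn fun i => gradient (P.f i) x - gradient (P.f i) y
  have e : (n : ℝ)⁻¹ • ∑ j, (gradient (P.f j) x - gradient (P.f j) y) =
      fullGrad P .firstOrder x - fullGrad P .firstOrder y := by
    simp [fullGrad, OracleModel.grad, Finset.sum_sub_distrib, smul_sub]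
  rw [e] at h1
  refine h1.trans ?_
  have e2 : 2 * L * (P.objective y - P.objective x -
      inner ℝ (fullGrad P .firstOrder x) (y - x)) = (n : ℝ)⁻¹ * ∑ i, 2 * L * (P.f i y - P.f i x -
      inner ℝ (gradient (P.f i) x) (y - x)) := by
    rw [avg_gradient_inner, Problem.objective, Problem.objective, ← Finset.mul_sum,
      Finset.sum_sub_distrib, Finset.sum_sub_distrib]
    ring
  rw [e2]
  gcongr with i
  rw [norm_sub_rev]
  exact (hP.smooth_f i).norm_gradient_sub_sq_le hL (hP.convex_f i) x y

lemma GradErrorLE.norm_fullGrad_sub_le (h : GradErrorLE P o b) (hn : 0 < n) (x : Vec d) :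
    ‖fullGrad P o x - fullGrad P .firstOrder x‖ ≤ b := by
  have e : fullGrad P o x - fullGrad P .firstOrder x =
      (n : ℝ)⁻¹ • ∑ i, (o.grad (P.f i) x - gradient (P.f i) x) := by
    simp [fullGrad, OracleModel.grad, Finset.sum_sub_distrib, smul_sub]
  rw [e, norm_smul, Real.norm_of_nonneg (by positivity), ← avg_const hn b]
  gcongr
  exact (norm_sum_le _ _).trans (Finset.sum_le_sum fun i _ => h i x)

lemma OracleModel.three_le_const (o : OracleModel) : 3 ≤ o.const := by
  cases o <;> norm_num [OracleModel.const]

lemma OracleModel.const_le_five (o : OracleModel) : o.const ≤ 5 := by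
  cases o <;> norm_num [OracleModel.const]

/-- The bound `|D| + 1` in place of `D` is positive, which also covers a one-point set `C`. -/
lemma Problem.Admissible.sq_dist_le (hP : P.Admissible L D) :
    ∀ x ∈ P.C, ∀ z ∈ P.C, ‖x - z‖ ^ 2 ≤ (|D| + 1) ^ 2 := fun x hx z hz => by
  have := hP.diam_C x hx z hz
  gcongr
  linarith [le_abs_self D]

variable {A : ARCSParams} {s t : ℕ}

/-- What is used of the parameters of one epoch: no strong convexity, pivot weight `1 / 2`, momentum
weight at most `1 / 2`, the step size that goes with it, and positive tolerances. -/
structure ARCSParams.Regular (A : ARCSParams) (o : OracleModel) (L : ℝ) (s : ℕ) : Prop where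
  τ_eq : A.τ = 0
  p_eq : A.p s = 1 / 2
  α_pos : 0 < A.α s
  α_le : A.α s ≤ 1 / 2
  γ_eq : A.γ s = 1 / (o.const * L * A.α s)
  η_pos : ∀ t, 0 < A.η s t

lemma innerStep_mem (hP : P.Admissible L D) (hA : A.Regular o L s) {xt gt : Vec d}
    (hxt : xt ∈ P.C) {σ : InnerState d} (hx : σ.x ∈ P.C) (hxbar : σ.xbar ∈ P.C) (i : Fin n) :
    (innerStep P o A s t xt gt i σ).x ∈ P.C ∧ (innerStep P o A s t xt gt i σ).xbar ∈ P.C := by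
  have h1 : (innerStep P o A s t xt gt i σ).x ∈ P.C := by
    simp only [innerStep, hA.τ_eq]
    exact (condG_spec hP.convex_C hP.lo_mem hP.lo_max (by positivity) hP.sq_dist_le (hA.η_pos t)
      hx).1
  refine ⟨h1, ?_⟩
  have e : (innerStep P o A s t xt gt i σ).xbar = (1 - A.α s - A.p s) • σ.xbar +
    A.α s • (innerStep P o A s t xt gt i σ).x + A.p s • xt := rfl
  rw [e]
  have h2 := hA.p_eq
  have h3 := hA.α_le
  have h4 := hA.α_pos
  have h5 := hP.convex_C.sum_mem (t := (Finset.univ : Finset (Fin 3)))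
    (w := ![1 - A.α s - A.p s, A.α s, A.p s])
    (z := ![σ.xbar, (innerStep P o A s t xt gt i σ).x, xt])
  simp only [Fin.sum_univ_three, Finset.mem_univ, forall_const, Fin.forall_fin_succ,
    Matrix.cons_val] at h5
  refine h5 ?_ (by ring) ?_
  · simp; refine ⟨?_, ?_, ?_⟩ <;> linarith
  · simp [hxt, h1, hxbar]

lemma innerStep_calls_le (hP : P.Admissible L D) (hA : A.Regular o L s) {xt gt : Vec d}
    {σ : InnerState d} (hx : σ.x ∈ P.C) (i : Fin n) :
    ∃ c : ℕ, (innerStep P o A s t xt gt i σ).loCalls = σ.loCalls + c ∧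
      (c : ℝ) ≤ 4 + 4 * ((|D| + 1) ^ 2 / A.η s t) := by
  simp only [innerStep, hA.τ_eq]
  obtain ⟨c, hc, hle⟩ := condGCalls_le (γ := A.γ s) (u := σ.x)
    hP.convex_C hP.lo_mem hP.lo_max (by positivity) hP.sq_dist_le (hA.η_pos t) hx
  exact ⟨c, by rw [hc], hle⟩

/-- The potential decrease of one inner iteration, averaged over the sampled index. -/
lemma innerStep_avg_le (hP : P.Admissible L D) (hL : 0 < L) (hn : 0 < n)
    (hb : GradErrorLE P o b) (hA : A.Regular o L s) {xt : Vec d} {σ : InnerState d}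
    (hx : σ.x ∈ P.C) :
    (n : ℝ)⁻¹ * ∑ i, (A.γ s / A.α s *
        (P.objective (innerStep P o A s t xt (fullGrad P o xt) i σ).xbar -
          P.objective P.xstar) +
        ‖(innerStep P o A s t xt (fullGrad P o xt) i σ).x - P.xstar‖ ^ 2 / 2) ≤
      A.γ s / A.α s * ((1 / 2 - A.α s) * (P.objective σ.xbar - P.objective P.xstar) +
        1 / 2 * (P.objective xt - P.objective P.xstar)) + ‖σ.x - P.xstar‖ ^ 2 / 2 +
      (A.η s t + A.γ s * (3 * b * D)) := by
  have hc := o.three_le_const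
  have hα := hA.α_pos
  have hγ0 : 0 < A.γ s := by rw [hA.γ_eq]; have : 0 < o.const := by linarith
                             positivity
  set xu : Vec d := (1 - A.α s - 1 / 2) • σ.xbar + A.α s • σ.x + (1 / 2 : ℝ) • xt with hxu
  set G : Fin n → Vec d := fun i => o.grad (P.f i) xu - o.grad (P.f i) xt + fullGrad P o xt with hG
  set xp : Fin n → Vec d := fun i => condG P.lo (G i) σ.x xu (A.γ s) 0 (A.η s t) with hxp
  set g := fullGrad P .firstOrder with hg
  set δ : Fin n → Vec d := fun i =>
    gradient (P.f i) xu - gradient (P.f i) xt - (g xu - g xt) with hδ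
  set e : Fin n → Vec d := fun i => (o.grad (P.f i) xu - gradient (P.f i) xu) -
    (o.grad (P.f i) xt - gradient (P.f i) xt) + (fullGrad P o xt - g xt) with he
  have ex : ∀ i, (innerStep P o A s t xt (fullGrad P o xt) i σ).x = xp i := by
    intro i
    simp [innerStep, hA.τ_eq, hA.p_eq, hxp, hG, hxu]
  have exb : ∀ i, (innerStep P o A s t xt (fullGrad P o xt) i σ).xbar =
      (1 - A.α s - 1 / 2) • σ.xbar + A.α s • xp i + (1 / 2 : ℝ) • xt := by
    intro i
    rw [← ex i, ← hA.p_eq]; rfl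
  have hGe : ∀ i, G i = g xu + δ i + e i := by
    intro i
    simp only [hG, hδ, he]; abel
  have hen : ∀ i, ‖e i‖ ≤ 3 * b := by
    intro i
    have h1 := hb i xu
    have h2 := hb i xt
    have h3 := hb.norm_fullGrad_sub_le hn xt
    have h4 := norm_add_le ((o.grad (P.f i) xu - gradient (P.f i) xu) -
      (o.grad (P.f i) xt - gradient (P.f i) xt)) (fullGrad P o xt - g xt)
    have h5 := norm_sub_le (o.grad (P.f i) xu - gradient (P.f i) xu)
      (o.grad (P.f i) xt - gradient (P.f i) xt)
    simp only [he]; linarith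
  have hspec : ∀ i, xp i ∈ P.C ∧ ∀ v ∈ P.C,
      inner ℝ (A.γ s • G i + (xp i - σ.x)) (xp i - v) ≤ A.η s t := fun i =>
    condG_spec hP.convex_C hP.lo_mem hP.lo_max (by positivity) hP.sq_dist_le (hA.η_pos t) hx
  have hpt : ∀ i, A.γ s / A.α s * (P.objective ((1 - A.α s - 1 / 2) • σ.xbar + A.α s • xp i +
        (1 / 2 : ℝ) • xt) - P.objective P.xstar) + ‖xp i - P.xstar‖ ^ 2 / 2 ≤
      (A.γ s / A.α s * ((1 / 2 - A.α s) * (P.objective σ.xbar - P.objective P.xstar) +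
        1 / 2 * (P.objective xu + inner ℝ (g xu) (xt - xu) - P.objective P.xstar)) +
        ‖σ.x - P.xstar‖ ^ 2 / 2 + (A.η s t + A.γ s * (3 * b * D))) +
      A.γ s / A.α s * (‖δ i‖ ^ 2 / (4 * L)) - A.γ s * inner ℝ (δ i) (σ.x - P.xstar) := by
    intro i
    have h1 := inner_step_pointwise (F := P.objective) hL hα hA.α_le hc hA.γ_eq
      (hP.objective_le_quadratic hn xu) (hP.le_objective hL xu) hxu
      ((hspec i).2 P.xstar hP.xstar_mem) (hGe i) (hen i)
      (hP.diam_C _ (hspec i).1 _ hP.xstar_mem)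
    have h2 := mul_le_mul_of_nonneg_left h1 (by positivity : 0 ≤ A.γ s / A.α s)
    have e1 : ∀ X, A.γ s / A.α s * (A.α s / A.γ s * X) = X := by intro X; field_simp
    have e2 : ∀ X, A.γ s / A.α s * (A.α s * X) = A.γ s * X := by intro X; field_simp
    have e3 := e1 (A.η s t + ‖σ.x - P.xstar‖ ^ 2 / 2 - ‖xp i - P.xstar‖ ^ 2 / 2)
    have e4 := e2 (inner ℝ (δ i) (σ.x - P.xstar))
    have e5 := e2 (3 * b * D)
    simp only [mul_add, mul_sub] at h2 e3 e4 e5 ⊢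
    linarith
  have hsum := Finset.sum_le_sum fun i (_ : i ∈ Finset.univ) => hpt i
  have hn0 : (0 : ℝ) ≤ (n : ℝ)⁻¹ := by positivity
  have havg := mul_le_mul_of_nonneg_left hsum hn0
  rw [avg_const_add_sub hn, ← Finset.mul_sum, ← Finset.mul_sum, ← sum_inner,
    ← Finset.sum_div] at havg
  have hδ0 : ∑ i, δ i = 0 := by
    have := sum_sub_avg_eq_zero hn fun i => gradient (P.f i) xu - gradient (P.f i) xt
    have e : (n : ℝ)⁻¹ • ∑ j, (gradient (P.f j) xu - gradient (P.f j) xt) = g xu - g xt := by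
      simp [hg, fullGrad, OracleModel.grad, Finset.sum_sub_distrib, smul_sub]
    rwa [e] at this
  rw [hδ0, inner_zero_left, mul_zero, mul_zero, sub_zero] at havg
  have hvar := hP.avg_norm_centred_sq_le hL hn xu xt
  have hvar2 : A.γ s / A.α s * ((n : ℝ)⁻¹ * ((∑ i, ‖δ i‖ ^ 2) / (4 * L))) ≤
      A.γ s / A.α s * (1 / 2 * (P.objective xt - P.objective xu -
        inner ℝ (g xu) (xt - xu))) := by
    refine mul_le_mul_of_nonneg_left ?_ (by positivity)
    rw [← mul_div_assoc, div_le_iff₀ (by positivity)]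
    refine hvar.trans (le_of_eq ?_)
    ring
  simp only [ex, exb]
  refine havg.trans ?_
  have e6 : (n : ℝ)⁻¹ * (A.γ s / A.α s * ((∑ i, ‖δ i‖ ^ 2) / (4 * L))) =
    A.γ s / A.α s * ((n : ℝ)⁻¹ * ((∑ i, ‖δ i‖ ^ 2) / (4 * L))) := by ring
  rw [e6]
  simp only [mul_add, mul_sub] at hvar2 ⊢
  linarith

end OneStep

/-! ### Averaging over the next sampled index -/

section Sampling

variable {n : ℕ} {Ω : Type*} [MeasurableSpace Ω] {Pr : Measure Ω} {ξ : ℕ → ℕ → Ω → Fin n}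

/-- A function of finitely many of the sampled indices factors through their tuple. -/
lemma exists_factor_of_depends {J : Finset (ℕ × ℕ)} {F : (ℕ → ℕ → Fin n) → ℝ} (hn : 0 < n)
    (hF : ∀ z z' : ℕ → ℕ → Fin n, (∀ p ∈ J, z p.1 p.2 = z' p.1 p.2) → F z = F z') :
    ∃ g : (J → Fin n) → ℝ, ∀ z, F z = g fun p => z p.1.1 p.1.2 := by
  classical
  refine ⟨fun r => F fun a b => if h : (a, b) ∈ J then r ⟨(a, b), h⟩ else ⟨0, hn⟩, fun z => ?_⟩
  refine hF _ _ fun p hp => ?_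
  simp [hp]

lemma IsUniformSampling.measurable_tuple (hξ : IsUniformSampling Pr ξ) (J : Finset (ℕ × ℕ)) :
    Measurable fun (ω : Ω) (p : J) => ξ p.1.1 p.1.2 ω :=
  measurable_pi_lambda _ fun _ => hξ.measurable _ _

/-- A function of finitely many of the sampled indices takes finitely many values. -/
lemma IsUniformSampling.integrable_of_depends [IsProbabilityMeasure Pr]
    (hξ : IsUniformSampling Pr ξ) (hn : 0 < n)
    {J : Finset (ℕ × ℕ)} {F : (ℕ → ℕ → Fin n) → ℝ}
    (hF : ∀ z z' : ℕ → ℕ → Fin n, (∀ p ∈ J, z p.1 p.2 = z' p.1 p.2) → F z = F z') :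
    Integrable (fun ω => F fun a b => ξ a b ω) Pr := by
  obtain ⟨g, hg⟩ := exists_factor_of_depends hn hF
  simp only [hg]
  have := Measure.isProbabilityMeasure_map (μ := Pr) (hξ.measurable_tuple J).aemeasurable
  exact (Integrable.of_finite (f := g)).comp_measurable (hξ.measurable_tuple J)

/-- The expectation over a fresh index, given the indices sampled so far, is the uniform
average. -/
lemma IsUniformSampling.integral_fresh [IsProbabilityMeasure Pr]
    (hξ : IsUniformSampling Pr ξ) (hn : 0 < n)
    {J : Finset (ℕ × ℕ)} {j : ℕ × ℕ} (hj : j ∉ J) {Φ : (ℕ → ℕ → Fin n) → Fin n → ℝ}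
    (hΦ : ∀ z z' : ℕ → ℕ → Fin n, (∀ p ∈ J, z p.1 p.2 = z' p.1 p.2) → Φ z = Φ z') :
    ∫ ω, Φ (fun a b => ξ a b ω) (ξ j.1 j.2 ω) ∂Pr =
      ∫ ω, (n : ℝ)⁻¹ * ∑ i, Φ (fun a b => ξ a b ω) i ∂Pr := by
  classical
  have hdep : ∀ i, ∀ z z' : ℕ → ℕ → Fin n, (∀ p ∈ J, z p.1 p.2 = z' p.1 p.2) →
      (fun z => Φ z i) z = (fun z => Φ z i) z' := fun i z z' h => by
    simp only [hΦ z z' h]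
  have hint : ∀ i, Integrable (fun ω => Φ (fun a b => ξ a b ω) i) Pr := fun i =>
    hξ.integrable_of_depends hn (F := fun z => Φ z i) (hdep i)
  have hind : IndepFun (fun ω => ξ j.1 j.2 ω) (fun ω (p : J) => ξ p.1.1 p.1.2 ω) Pr := by
    have h1 := hξ.indep.indepFun_finset {j} J (by simpa using hj) fun p => hξ.measurable _ _
    exact h1.comp (φ := fun r : ({j} : Finset (ℕ × ℕ)) → Fin n => r ⟨j, by simp⟩) (ψ := id)
      (measurable_pi_apply _) measurable_id
  have hone : ∀ i, ∫ ω, (if ξ j.1 j.2 ω = i then (1 : ℝ) else 0) * Φ (fun a b => ξ a b ω) i ∂Pr =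
      (n : ℝ)⁻¹ * ∫ ω, Φ (fun a b => ξ a b ω) i ∂Pr := by
    intro i
    obtain ⟨g, hg⟩ := exists_factor_of_depends hn (hdep i)
    have hm : Measurable fun k : Fin n => if k = i then (1 : ℝ) else 0 := .of_discrete
    have hind2 : IndepFun (fun ω => if ξ j.1 j.2 ω = i then (1 : ℝ) else 0)
        (fun ω => Φ (fun a b => ξ a b ω) i) Pr := by
      have h1 := hind.comp hm (Measurable.of_discrete (f := g))
      have h2 : (fun ω => Φ (fun a b => ξ a b ω) i) =
        g ∘ fun ω (p : J) => ξ p.1.1 p.1.2 ω := by funext ω; exact hg _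
      rw [h2]; exact h1
    rw [hind2.integral_fun_mul_eq_mul_integral
      (hm.comp (hξ.measurable _ _)).aestronglyMeasurable (hint i).aestronglyMeasurable]
    congr 1
    have hset : MeasurableSet {ω | ξ j.1 j.2 ω = i} :=
      hξ.measurable _ _ (measurableSet_singleton i)
    have h3 : (fun ω => if ξ j.1 j.2 ω = i then (1 : ℝ) else 0) =
        Set.indicator {ω | ξ j.1 j.2 ω = i} 1 := by
      funext ω; simp [Set.indicator_apply]
    rw [h3, integral_indicator_one hset, measureReal_def, hξ.uniform]
    simp
  have hsplit : ∀ ω, Φ (fun a b => ξ a b ω) (ξ j.1 j.2 ω) =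
      ∑ i, (if ξ j.1 j.2 ω = i then (1 : ℝ) else 0) * Φ (fun a b => ξ a b ω) i := by
    intro ω; simp
  simp only [hsplit]
  rw [integral_finsetSum, integral_const_mul, integral_finsetSum _ fun i _ => hint i,
    Finset.mul_sum]
  · exact Finset.sum_congr rfl fun i _ => hone i
  · intro i _
    have hset : MeasurableSet {ω | ξ j.1 j.2 ω = i} :=
      hξ.measurable _ _ (measurableSet_singleton i)
    refine ((hint i).indicator hset).congr (ae_of_all _ fun ω => ?_)
    simp [Set.indicator_apply]

end Sampling

/-! ### One epoch in expectation -/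

section Epoch

variable {n d : ℕ} {P : Problem n d} {o : OracleModel} {A : ARCSParams} {L D b : ℝ}

lemma innerRun_congr {s : ℕ} {z z' : ℕ → Fin n} {σ : EpochState d} {t : ℕ}
    (h : ∀ k ≤ t, z k = z' k) : innerRun P o A s z σ t = innerRun P o A s z' σ t := by
  induction t with
  | zero => rfl
  | succ t ih => rw [innerRun, innerRun, ih fun k hk => h k (by omega), h (t + 1) le_rfl]

lemma arcs_congr {z z' : ℕ → ℕ → Fin n} {S : ℕ}
    (h : ∀ a ≤ S, ∀ k ≤ A.T a, z a k = z' a k) : arcs P o A z S = arcs P o A z' S := by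
  induction S with
  | zero => rfl
  | succ S ih =>
    rw [arcs, arcs, ih fun a ha => h a (by omega)]
    have hr : ∀ t ≤ A.T (S + 1), innerRun P o A (S + 1) (z (S + 1)) (arcs P o A z' S) t =
        innerRun P o A (S + 1) (z' (S + 1)) (arcs P o A z' S) t := fun t ht =>
      innerRun_congr fun k hk => h _ le_rfl k (hk.trans ht)
    have hs : ∑ t ∈ Finset.Icc 1 (A.T (S + 1)), A.θ (S + 1) t •
        (innerRun P o A (S + 1) (z (S + 1)) (arcs P o A z' S) t).xbar =
        ∑ t ∈ Finset.Icc 1 (A.T (S + 1)), A.θ (S + 1) t •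
        (innerRun P o A (S + 1) (z' (S + 1)) (arcs P o A z' S) t).xbar :=
      Finset.sum_congr rfl fun t ht => by rw [hr t (Finset.mem_Icc.1 ht).2]
    simp only [epoch, hr _ le_rfl, hs]

/-- The positions of the indices sampled before iteration `t + 1` of epoch `s`. -/
def pastIndices (A : ARCSParams) (s t : ℕ) : Finset (ℕ × ℕ) :=
  (Finset.range s).biUnion (fun a => {a} ×ˢ Finset.range (A.T a + 1)) ∪
    {s} ×ˢ Finset.range (t + 1)

lemma arcs_innerRun_congr {z z' : ℕ → ℕ → Fin n} {S t : ℕ}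
    (h : ∀ p ∈ pastIndices A (S + 1) t, z p.1 p.2 = z' p.1 p.2) :
    arcs P o A z S = arcs P o A z' S ∧
    innerRun P o A (S + 1) (z (S + 1)) (arcs P o A z' S) t =
      innerRun P o A (S + 1) (z' (S + 1)) (arcs P o A z' S) t := by
  refine ⟨arcs_congr fun a ha k hk => h (a, k) ?_, innerRun_congr fun k hk => h (S + 1, k) ?_⟩
  · simp only [pastIndices, Finset.mem_union, Finset.mem_biUnion, Finset.mem_product,
      Finset.mem_singleton, Finset.mem_range]
    exact Or.inl ⟨a, by omega, rfl, by omega⟩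
  · simp only [pastIndices, Finset.mem_union, Finset.mem_product, Finset.mem_singleton,
      Finset.mem_range]
    exact Or.inr ⟨trivial, by omega⟩

lemma notMem_pastIndices (A : ARCSParams) (S t : ℕ) : (S + 1, t + 1) ∉ pastIndices A (S + 1) t := by
  simp [pastIndices]

/-- The averaging weights of an epoch, and tolerances that do not change within it. -/
structure ARCSParams.RegularEpoch (A : ARCSParams) (o : OracleModel) (L : ℝ) (s : ℕ) : Prop
    extends A.Regular o L s where
  T_pos : 0 < A.T s
  θ_eq : ∀ t, A.θ s t =
    if t < A.T s then A.γ s / A.α s * (A.α s + 1 / 2) else A.γ s / A.α s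
  η_const : ∀ t, A.η s t = A.η s 0

lemma ARCSParams.Regular.gamma_pos {s : ℕ} (hA : A.Regular o L s) (hL : 0 < L) : 0 < A.γ s := by
  have := o.three_le_const
  have := hA.α_pos
  rw [hA.γ_eq]; positivity

lemma ARCSParams.RegularEpoch.sum_theta_mul {s : ℕ} (hA : A.RegularEpoch o L s) (F : ℕ → ℝ) :
    ∑ t ∈ Finset.Icc 1 (A.T s), A.θ s t * F t =
      A.γ s / A.α s * (F (A.T s) + (A.α s + 1 / 2) * ∑ t ∈ Finset.Ico 1 (A.T s), F t) := by
  have hT := hA.T_pos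
  have hI : Finset.Icc 1 (A.T s) = insert (A.T s) (Finset.Ico 1 (A.T s)) := by
    ext t; simp; omega
  rw [hI, Finset.sum_insert (by simp), hA.θ_eq, if_neg (lt_irrefl _), mul_add, ← mul_assoc,
    Finset.mul_sum]
  congr 1
  refine Finset.sum_congr rfl fun t ht => ?_
  rw [hA.θ_eq, if_pos (Finset.mem_Ico.1 ht).2]

lemma ARCSParams.RegularEpoch.sum_theta {s : ℕ} (hA : A.RegularEpoch o L s) :
    ∑ t ∈ Finset.Icc 1 (A.T s), A.θ s t =
      A.γ s / A.α s * (1 + (A.T s - 1) * (A.α s + 1 / 2)) := by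
  have hT := hA.T_pos
  have := hA.sum_theta_mul fun _ => 1
  simp only [mul_one, Finset.sum_const, Nat.card_Ico, nsmul_eq_mul] at this
  rw [this, Nat.cast_sub hT]
  push_cast; ring

lemma ARCSParams.RegularEpoch.sum_theta_pos {s : ℕ} (hA : A.RegularEpoch o L s) (hL : 0 < L) :
    0 < ∑ t ∈ Finset.Icc 1 (A.T s), A.θ s t := by
  have := hA.gamma_pos hL
  have := hA.α_pos
  have hT : (1 : ℝ) ≤ A.T s := by exact_mod_cast hA.T_pos
  have : 0 ≤ ((A.T s : ℝ) - 1) * (A.α s + 1 / 2) := mul_nonneg (by linarith) (by linarith)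
  rw [hA.sum_theta]; positivity

lemma ARCSParams.RegularEpoch.theta_nonneg {s : ℕ} (hA : A.RegularEpoch o L s) (hL : 0 < L)
    (t : ℕ) : 0 ≤ A.θ s t := by
  have := hA.gamma_pos hL
  have := hA.α_pos
  rw [hA.θ_eq]
  split_ifs <;> positivity

lemma innerRun_mem (hP : P.Admissible L D) {s : ℕ} (hA : A.Regular o L s) {z : ℕ → Fin n}
    {σ : EpochState d} (hx : σ.x ∈ P.C) (hxt : σ.xtilde ∈ P.C) (t : ℕ) :
    (innerRun P o A s z σ t).x ∈ P.C ∧ (innerRun P o A s z σ t).xbar ∈ P.C := by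
  induction t with
  | zero => exact ⟨hx, hxt⟩
  | succ t ih => exact innerStep_mem hP hA hxt ih.1 ih.2 _

lemma epoch_mem (hP : P.Admissible L D) (hL : 0 < L) {s : ℕ} (hA : A.RegularEpoch o L s)
    {z : ℕ → Fin n} {σ : EpochState d} (hx : σ.x ∈ P.C) (hxt : σ.xtilde ∈ P.C) :
    (epoch P o A s z σ).x ∈ P.C ∧ (epoch P o A s z σ).xtilde ∈ P.C := by
  have h := innerRun_mem (z := z) hP hA.toRegular hx hxt
  refine ⟨(h _).1, ?_⟩
  exact hP.convex_C.centerMass_mem (fun t _ => hA.theta_nonneg hL t) (hA.sum_theta_pos hL)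
    fun t _ => (h t).2

lemma arcs_mem (hP : P.Admissible L D) (hL : 0 < L) (hA : ∀ s, A.RegularEpoch o L (s + 1))
    (z : ℕ → ℕ → Fin n) (S : ℕ) :
    (arcs P o A z S).x ∈ P.C ∧ (arcs P o A z S).xtilde ∈ P.C := by
  induction S with
  | zero => exact ⟨hP.x₀_mem, hP.x₀_mem⟩
  | succ S ih => exact epoch_mem hP hL (hA S) ih.1 ih.2

lemma Problem.Admissible.convexOn_objective (hP : P.Admissible L D) :
    ConvexOn ℝ Set.univ P.objective := by
  have h : ConvexOn ℝ Set.univ (∑ i, P.f i) := by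
    refine Finset.sum_induction _ (fun g => ConvexOn ℝ Set.univ g) (fun _ _ h1 h2 => h1.add h2) ?_
      fun i _ => hP.convex_f i
    exact convexOn_const 0 convex_univ
  have h2 := h.smul (by positivity : (0 : ℝ) ≤ (n : ℝ)⁻¹)
  refine h2.congr fun x _ => ?_
  simp [Problem.objective]

/-- Jensen's inequality for the output of an epoch. -/
lemma sum_theta_mul_epoch_le (hP : P.Admissible L D) (hL : 0 < L) {s : ℕ}
    (hA : A.RegularEpoch o L s) (z : ℕ → Fin n) (σ : EpochState d) :
    (∑ t ∈ Finset.Icc 1 (A.T s), A.θ s t) *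
        (P.objective (epoch P o A s z σ).xtilde - P.objective P.xstar) ≤
      ∑ t ∈ Finset.Icc 1 (A.T s), A.θ s t *
        (P.objective (innerRun P o A s z σ t).xbar - P.objective P.xstar) := by
  have hpos := hA.sum_theta_pos hL
  have h := hP.convexOn_objective.map_centerMass_le (t := Finset.Icc 1 (A.T s)) (w := A.θ s)
    (p := fun t => (innerRun P o A s z σ t).xbar) (fun t _ => hA.theta_nonneg hL t) hpos
    fun _ _ => Set.mem_univ _
  have e : (epoch P o A s z σ).xtilde = (Finset.Icc 1 (A.T s)).centerMass (A.θ s)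
    fun t => (innerRun P o A s z σ t).xbar := rfl
  rw [← e, Finset.centerMass, smul_eq_mul, inv_mul_eq_div, le_div_iff₀ hpos] at h
  simp only [smul_eq_mul, Function.comp] at h
  simp only [mul_sub, Finset.sum_sub_distrib, ← Finset.sum_mul]
  linarith

variable {Ω : Type*} [MeasurableSpace Ω] {Pr : Measure Ω} [IsProbabilityMeasure Pr]
  {ξ : ℕ → ℕ → Ω → Fin n}

/-- Any function of an intermediate state is integrable. -/
lemma integrable_innerRun (hξ : IsUniformSampling Pr ξ) (hn : 0 < n) (S t : ℕ)
    (F : InnerState d → EpochState d → ℝ) :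
    Integrable (fun ω => F (innerRun P o A (S + 1) (fun k => ξ (S + 1) k ω)
      (arcs P o A (fun a k => ξ a k ω) S) t) (arcs P o A (fun a k => ξ a k ω) S)) Pr := by
  refine hξ.integrable_of_depends hn (J := pastIndices A (S + 1) t)
    (F := fun z => F (innerRun P o A (S + 1) (z (S + 1)) (arcs P o A z S) t) (arcs P o A z S))
    fun z z' h => ?_
  obtain ⟨h1, h2⟩ := arcs_innerRun_congr (P := P) (o := o) h
  simp only [h1, h2]

lemma integrable_arcs (hξ : IsUniformSampling Pr ξ) (hn : 0 < n) (S : ℕ)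
    (F : EpochState d → ℝ) :
    Integrable (fun ω => F (arcs P o A (fun a k => ξ a k ω) S)) Pr :=
  integrable_innerRun hξ hn S 0 fun _ σ => F σ

/-- The potential decrease of one inner iteration, in expectation. -/
lemma integral_innerRun_succ_le (hP : P.Admissible L D) (hL : 0 < L) (hn : 0 < n)
    (hb : GradErrorLE P o b) (hA : ∀ s, A.RegularEpoch o L (s + 1)) (hξ : IsUniformSampling Pr ξ)
    (S t : ℕ) {R : ℕ → Ω → InnerState d} {σ : Ω → EpochState d}
    (hσ : σ = fun ω => arcs P o A (fun a k => ξ a k ω) S)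
    (hR : R = fun t ω => innerRun P o A (S + 1) (fun k => ξ (S + 1) k ω) (σ ω) t) :
    A.γ (S + 1) / A.α (S + 1) *
        (∫ ω, P.objective (R (t + 1) ω).xbar - P.objective P.xstar ∂Pr) +
        ∫ ω, ‖(R (t + 1) ω).x - P.xstar‖ ^ 2 / 2 ∂Pr ≤
      A.γ (S + 1) / A.α (S + 1) * ((1 / 2 - A.α (S + 1)) *
        (∫ ω, P.objective (R t ω).xbar - P.objective P.xstar ∂Pr) +
        1 / 2 * ∫ ω, P.objective (σ ω).xtilde - P.objective P.xstar ∂Pr) +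
      (∫ ω, ‖(R t ω).x - P.xstar‖ ^ 2 / 2 ∂Pr) +
      (A.η (S + 1) 0 + A.γ (S + 1) * (3 * b * D)) := by
  have hi : ∀ t (F : InnerState d → EpochState d → ℝ), Integrable (fun ω => F (R t ω) (σ ω)) Pr := by
    intro t F
    subst hR hσ
    exact integrable_innerRun hξ hn S t F
  have i1 := fun t => hi t fun r _ => P.objective r.xbar - P.objective P.xstar
  have i2 := fun t => hi t fun r _ => ‖r.x - P.xstar‖ ^ 2 / 2
  have i3 := hi 0 fun _ s => P.objective s.xtilde - P.objective P.xstar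
  set κ := A.γ (S + 1) / A.α (S + 1) with hκ
  set α := A.α (S + 1) with hα
  have hfresh := hξ.integral_fresh hn (j := (S + 1, t + 1)) (notMem_pastIndices A S t)
    (Φ := fun z i => κ * (P.objective (innerStep P o A (S + 1) (t + 1) (arcs P o A z S).xtilde
        (fullGrad P o (arcs P o A z S).xtilde) i
        (innerRun P o A (S + 1) (z (S + 1)) (arcs P o A z S) t)).xbar - P.objective P.xstar) +
      ‖(innerStep P o A (S + 1) (t + 1) (arcs P o A z S).xtilde
        (fullGrad P o (arcs P o A z S).xtilde) i
        (innerRun P o A (S + 1) (z (S + 1)) (arcs P o A z S) t)).x - P.xstar‖ ^ 2 / 2)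
    fun z z' h => by
      obtain ⟨h1, h2⟩ := arcs_innerRun_congr (P := P) (o := o) h
      simp only [h1, h2]
  have hlhs : κ * (∫ ω, P.objective (R (t + 1) ω).xbar - P.objective P.xstar ∂Pr) +
      ∫ ω, ‖(R (t + 1) ω).x - P.xstar‖ ^ 2 / 2 ∂Pr =
      ∫ ω, κ * (P.objective (R (t + 1) ω).xbar - P.objective P.xstar) +
        ‖(R (t + 1) ω).x - P.xstar‖ ^ 2 / 2 ∂Pr := by
    rw [integral_add ((i1 _).const_mul _) (i2 _), integral_const_mul]
  have hrhs : κ * ((1 / 2 - α) * (∫ ω, P.objective (R t ω).xbar - P.objective P.xstar ∂Pr) +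
        1 / 2 * ∫ ω, P.objective (σ ω).xtilde - P.objective P.xstar ∂Pr) +
      (∫ ω, ‖(R t ω).x - P.xstar‖ ^ 2 / 2 ∂Pr) +
      (A.η (S + 1) 0 + A.γ (S + 1) * (3 * b * D)) =
      ∫ ω, κ * ((1 / 2 - α) * (P.objective (R t ω).xbar - P.objective P.xstar) +
        1 / 2 * (P.objective (σ ω).xtilde - P.objective P.xstar)) +
        ‖(R t ω).x - P.xstar‖ ^ 2 / 2 + (A.η (S + 1) 0 + A.γ (S + 1) * (3 * b * D)) ∂Pr := by
    have j1 : Integrable (fun ω => (1 / 2 - α) *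
        (P.objective (R t ω).xbar - P.objective P.xstar)) Pr := (i1 t).const_mul _
    have j2 : Integrable (fun ω => 1 / 2 *
        (P.objective (σ ω).xtilde - P.objective P.xstar)) Pr := i3.const_mul _
    have j3 : Integrable (fun ω => κ * ((1 / 2 - α) *
        (P.objective (R t ω).xbar - P.objective P.xstar) +
        1 / 2 * (P.objective (σ ω).xtilde - P.objective P.xstar))) Pr := (j1.add j2).const_mul _
    have j4 : Integrable (fun ω => κ * ((1 / 2 - α) *
        (P.objective (R t ω).xbar - P.objective P.xstar) +
        1 / 2 * (P.objective (σ ω).xtilde - P.objective P.xstar)) +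
        ‖(R t ω).x - P.xstar‖ ^ 2 / 2) Pr := j3.add (i2 t)
    rw [integral_add j4 (integrable_const _), integral_add j3 (i2 t), integral_const_mul,
      integral_add j1 j2, integral_const_mul, integral_const_mul]
    simp
  rw [hlhs, hrhs]
  have e : ∀ ω, R (t + 1) ω = innerStep P o A (S + 1) (t + 1) (σ ω).xtilde
      (fullGrad P o (σ ω).xtilde) (ξ (S + 1) (t + 1) ω) (R t ω) := by
    intro ω; rw [hR]; rfl
  simp only [e]
  have e2 : ∀ ω, R t ω = innerRun P o A (S + 1) (fun k => ξ (S + 1) k ω) (σ ω) t := by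
    intro ω; rw [hR]
  have e3 : ∀ ω, σ ω = arcs P o A (fun a k => ξ a k ω) S := by
    intro ω; rw [hσ]
  simp only [← e3, ← e2] at hfresh
  rw [hfresh]
  refine integral_mono ?_ (hi t fun r s => κ * ((1 / 2 - α) *
        (P.objective r.xbar - P.objective P.xstar) +
        1 / 2 * (P.objective s.xtilde - P.objective P.xstar)) +
        ‖r.x - P.xstar‖ ^ 2 / 2 + (A.η (S + 1) 0 + A.γ (S + 1) * (3 * b * D))) fun ω => ?_
  · exact hi t fun r s => (n : ℝ)⁻¹ * ∑ i, (κ * (P.objective (innerStep P o A (S + 1) (t + 1)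
      s.xtilde (fullGrad P o s.xtilde) i r).xbar - P.objective P.xstar) +
      ‖(innerStep P o A (S + 1) (t + 1) s.xtilde (fullGrad P o s.xtilde) i r).x -
        P.xstar‖ ^ 2 / 2)
  · have hσC := arcs_mem hP hL hA (fun a k => ξ a k ω) S
    rw [← e3] at hσC
    have hrC := innerRun_mem (z := fun k => ξ (S + 1) k ω) hP (hA S).toRegular hσC.1 hσC.2 t
    rw [← e2] at hrC
    have := innerStep_avg_le (t := t + 1) (xt := (σ ω).xtilde) hP hL hn hb (hA S).toRegular hrC.1
    rwa [(hA S).η_const] at this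

/-- Summation of the recursion of one epoch; `e` and `q` stand for the expected suboptimality and
the expected half squared distance to the solution. -/
lemma epoch_recursion_sum {κ α ρ et : ℝ} {e q : ℕ → ℝ} (h0 : e 0 = et)
    (h : ∀ t, κ * e (t + 1) + q (t + 1) ≤ κ * ((1 / 2 - α) * e t + 1 / 2 * et) + q t + ρ) (t : ℕ) :
    κ * (e (t + 1) + (α + 1 / 2) * ∑ k ∈ Finset.Ico 1 (t + 1), e k) + q (t + 1) ≤
      κ * (1 / 2 - α + (t + 1 : ℕ) / 2) * et + q 0 + (t + 1 : ℕ) * ρ := by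
  induction t with
  | zero =>
    have := h 0
    rw [h0] at this
    simp
    linarith
  | succ t ih =>
    have := h (t + 1)
    rw [Finset.sum_Ico_succ_top (by omega)]
    push_cast at ih ⊢
    linarith

/-- The potential decrease of one epoch, in expectation. -/
lemma integral_arcs_succ_le (hP : P.Admissible L D) (hL : 0 < L) (hn : 0 < n)
    (hb : GradErrorLE P o b) (hA : ∀ s, A.RegularEpoch o L (s + 1)) (hξ : IsUniformSampling Pr ξ)
    (S : ℕ) {Y : ℕ → Ω → EpochState d}
    (hY : Y = fun S ω => arcs P o A (fun a k => ξ a k ω) S) :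
    A.γ (S + 1) / A.α (S + 1) * (1 + (A.T (S + 1) - 1) * (A.α (S + 1) + 1 / 2)) *
        (∫ ω, P.objective (Y (S + 1) ω).xtilde - P.objective P.xstar ∂Pr) +
        ∫ ω, ‖(Y (S + 1) ω).x - P.xstar‖ ^ 2 / 2 ∂Pr ≤
      A.γ (S + 1) / A.α (S + 1) * (1 / 2 - A.α (S + 1) + A.T (S + 1) / 2) *
        (∫ ω, P.objective (Y S ω).xtilde - P.objective P.xstar ∂Pr) +
        (∫ ω, ‖(Y S ω).x - P.xstar‖ ^ 2 / 2 ∂Pr) +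
      A.T (S + 1) * (A.η (S + 1) 0 + A.γ (S + 1) * (3 * b * D)) := by
  set R : ℕ → Ω → InnerState d := fun t ω =>
    innerRun P o A (S + 1) (fun k => ξ (S + 1) k ω) (Y S ω) t with hR
  have hrec := fun t => integral_innerRun_succ_le hP hL hn hb hA hξ S t (σ := Y S) (R := R)
    (by rw [hY]) hR
  obtain ⟨t, ht⟩ : ∃ t, A.T (S + 1) = t + 1 := ⟨A.T (S + 1) - 1, by have := (hA S).T_pos; omega⟩
  have hi : ∀ t, Integrable (fun ω => P.objective (R t ω).xbar - P.objective P.xstar) Pr := by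
    intro t
    rw [hR, hY]
    exact integrable_innerRun hξ hn S t fun r _ => P.objective r.xbar - P.objective P.xstar
  have hsum := epoch_recursion_sum
    (e := fun t => ∫ ω, P.objective (R t ω).xbar - P.objective P.xstar ∂Pr)
    (q := fun t => ∫ ω, ‖(R t ω).x - P.xstar‖ ^ 2 / 2 ∂Pr) rfl hrec t
  rw [← ht] at hsum
  rw [← (hA S).sum_theta_mul fun t => ∫ ω, P.objective (R t ω).xbar - P.objective P.xstar ∂Pr]
    at hsum
  have hx : ∀ ω, (Y (S + 1) ω).x = (R (A.T (S + 1)) ω).x := by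
    intro ω; rw [hR, hY]; rfl
  simp only [hx]
  refine (add_le_add_left ?_ _).trans hsum
  · rw [← (hA S).sum_theta, ← integral_const_mul]
    simp only [← integral_const_mul]
    rw [← integral_finsetSum _ fun t _ => (hi t).const_mul _]
    refine integral_mono ?_ (integrable_finsetSum _ fun t _ => (hi t).const_mul _) fun ω => ?_
    · rw [hY]
      exact (integrable_arcs hξ hn (S + 1) fun s =>
        P.objective s.xtilde - P.objective P.xstar).const_mul _
    · have := sum_theta_mul_epoch_le hP hL (hA S) (fun k => ξ (S + 1) k ω) (Y S ω)
      have e : Y (S + 1) ω = epoch P o A (S + 1) (fun k => ξ (S + 1) k ω) (Y S ω) := by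
        rw [hY]; rfl
      rw [e]
      exact this

end Epoch

/-! ### The parameters for convex problems and the convergence rate -/

section ConvexParams

variable {n d : ℕ} {o : OracleModel} {L D D₀ b : ℝ}

lemma one_le_sZero (n : ℕ) : 1 ≤ sZero n := by simp [sZero]

lemma convexT_eq (n s : ℕ) : convexT n s = 2 ^ (min s (sZero n) - 1) := by
  rw [convexT]
  split_ifs with h
  · rw [min_eq_left h]
  · rw [min_eq_right (by omega)]

lemma convexα_eq (n s : ℕ) : convexα n s = 2 / (((s - sZero n : ℕ) : ℝ) + 4) := by
  rw [convexα]
  split_ifs with h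
  · rw [Nat.sub_eq_zero_of_le h]; norm_num
  · rw [Nat.cast_sub (by omega)]

lemma convexT_le (hn : 0 < n) (s : ℕ) : convexT n s ≤ n := by
  rw [convexT_eq]
  calc 2 ^ (min s (sZero n) - 1) ≤ 2 ^ Nat.log 2 n :=
        Nat.pow_le_pow_right (by norm_num) (by have := min_le_right s (sZero n)
                                               simp only [sZero] at *; omega)
    _ ≤ n := Nat.pow_log_le_self 2 hn.ne'

lemma convexT_pos (n s : ℕ) : 0 < convexT n s := by rw [convexT_eq]; positivity

lemma convexParams_regularEpoch (hL : 0 < L) (hD₀ : 0 < D₀) (s : ℕ) :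
    (convexParams n o L D₀).RegularEpoch o L (s + 1) where
  τ_eq := rfl
  p_eq := rfl
  α_pos := by
    change 0 < convexα n (s + 1)
    rw [convexα_eq]; positivity
  α_le := by
    change convexα n (s + 1) ≤ 1 / 2
    rw [convexα_eq, div_le_div_iff₀ (by positivity) (by norm_num)]
    have : (0 : ℝ) ≤ ((s + 1 - sZero n : ℕ) : ℝ) := Nat.cast_nonneg _
    linarith
  γ_eq := rfl
  η_pos := fun t => by
    have := convexT_pos n (s + 1)
    change 0 < D₀ / (((s + 1 : ℕ) : ℝ) * convexT n (s + 1) * L)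
    positivity
  T_pos := convexT_pos n (s + 1)
  θ_eq := fun t => rfl
  η_const := fun t => rfl

/-- The convergence rate of the method is of the order `(2 + log S) / rateWeight n S`: the weight doubles
with every epoch up to `sZero n`, and grows quadratically afterwards. -/
def rateWeight (n S : ℕ) : ℝ := convexT n S * (((S - sZero n : ℕ) : ℝ) + 4) ^ 2

/-- The weight of the suboptimality at the end of epoch `s` in the telescoping recursion. -/
def weightAfter (n : ℕ) (o : OracleModel) (L : ℝ) (s : ℕ) : ℝ :=
  convexγ n o L s / convexα n s * (1 + (convexT n s - 1) * (convexα n s + 1 / 2))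

/-- The weight of the suboptimality at the start of epoch `s` in the telescoping recursion. -/
def weightBefore (n : ℕ) (o : OracleModel) (L : ℝ) (s : ℕ) : ℝ :=
  convexγ n o L s / convexα n s * (1 / 2 - convexα n s + convexT n s / 2)

lemma convexγ_div_convexα (hL : 0 < L) (s : ℕ) : convexγ n o L s / convexα n s =
    (((s - sZero n : ℕ) : ℝ) + 4) ^ 2 / (4 * o.const * L) := by
  have := o.three_le_const
  rw [convexγ, convexα_eq]
  field_simp
  ring

/-- The weights of consecutive epochs match: with equality while the epoch length doubles, and by the
choice of the momentum weights afterwards. -/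
lemma weightBefore_succ_le (hL : 0 < L) {s : ℕ} (hs : 0 < s) :
    weightBefore n o L (s + 1) ≤ weightAfter n o L s := by
  have hc3 := o.three_le_const
  have hT := convexT_pos n s
  have hT1 : (1 : ℝ) ≤ convexT n s := by exact_mod_cast hT
  rw [weightBefore, weightAfter, convexγ_div_convexα hL, convexγ_div_convexα hL, convexα_eq,
    convexα_eq]
  rcases Nat.lt_or_ge s (sZero n) with h | h
  · have e1 : s + 1 - sZero n = 0 := by omega
    have e2 : s - sZero n = 0 := by omega
    have e3 : convexT n (s + 1) = 2 * convexT n s := by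
      rw [convexT_eq, convexT_eq, min_eq_left h.le, min_eq_left (by omega : s + 1 ≤ sZero n),
        ← pow_succ']
      congr 1; omega
    rw [e1, e2, e3]
    push_cast
    refine le_of_eq ?_
    ring
  · have e1 : s + 1 - sZero n = (s - sZero n) + 1 := by omega
    have e3 : convexT n (s + 1) = convexT n s := by
      rw [convexT_eq, convexT_eq, min_eq_right h, min_eq_right (by omega : sZero n ≤ s + 1)]
    rw [e1, e3]
    push_cast
    set k : ℝ := ((s - sZero n : ℕ) : ℝ)
    have hk : 0 ≤ k := Nat.cast_nonneg _
    set T : ℝ := ((convexT n s : ℕ) : ℝ)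
    rw [div_mul_eq_mul_div, div_mul_eq_mul_div]
    refine div_le_div_of_nonneg_right ?_ (by positivity)
    have d1 : (k + 1 + 4) ^ 2 * (1 / 2 - 2 / (k + 1 + 4) + T / 2) =
        (k + 5) ^ 2 * (T + 1) / 2 - 2 * (k + 5) := by
      field_simp; ring
    have d2 : (k + 4) ^ 2 * (1 + (T - 1) * (2 / (k + 4) + 1 / 2)) =
        (k + 4) ^ 2 * (T + 1) / 2 + 2 * (T - 1) * (k + 4) := by
      field_simp; ring
    rw [d1, d2]
    nlinarith [mul_nonneg hk (sub_nonneg.2 hT1)]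

lemma weightBefore_one (hL : 0 < L) : weightBefore n o L 1 = 2 / (o.const * L) := by
  have hc3 := o.three_le_const
  have h1 := one_le_sZero n
  have e1 : 1 - sZero n = 0 := by omega
  rw [weightBefore, convexγ_div_convexα hL, convexα_eq, convexT_eq, min_eq_left h1, e1]
  norm_num
  field_simp
  norm_num

lemma rateWeight_le_weightAfter (hL : 0 < L) (s : ℕ) :
    rateWeight n s / (8 * o.const * L) ≤ weightAfter n o L s := by
  have hc3 := o.three_le_const
  have hT1 : (1 : ℝ) ≤ convexT n s := by exact_mod_cast convexT_pos n s
  rw [rateWeight, weightAfter, convexγ_div_convexα hL]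
  have hα : 0 ≤ convexα n s := by rw [convexα_eq]; positivity
  have h1 : (convexT n s : ℝ) / 2 ≤ 1 + (convexT n s - 1) * (convexα n s + 1 / 2) := by
    nlinarith [mul_nonneg (sub_nonneg.2 hT1) hα]
  calc convexT n s * (((s - sZero n : ℕ) : ℝ) + 4) ^ 2 / (8 * o.const * L)
      = (((s - sZero n : ℕ) : ℝ) + 4) ^ 2 / (4 * o.const * L) * (convexT n s / 2) := by
        field_simp; norm_num
    _ ≤ _ := by gcongr

variable {P : Problem n d}

lemma sub_objective_nonneg (hP : P.Admissible L D) (hL : 0 < L) (hD₀ : 0 < D₀)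
    (z : ℕ → ℕ → Fin n) (S : ℕ) :
    0 ≤ P.objective (arcs P o (convexParams n o L D₀) z S).xtilde - P.objective P.xstar :=
  sub_nonneg.2 (hP.xstar_min _ (arcs_mem hP hL (convexParams_regularEpoch hL hD₀) _ S).2)

variable {Ω : Type*} [MeasurableSpace Ω] {Pr : Measure Ω} [IsProbabilityMeasure Pr]
  {ξ : ℕ → ℕ → Ω → Fin n}

/-- Telescoping of the epochs. -/
lemma weightAfter_mul_integral_le (hP : P.Admissible L D) (hL : 0 < L) (hD₀ : 0 < D₀) (hn : 0 < n)
    (hb : GradErrorLE P o b) (hξ : IsUniformSampling Pr ξ) (hPD : P.dZero o L = D₀)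
    {Y : ℕ → Ω → EpochState d}
    (hY : Y = fun S ω => arcs P o (convexParams n o L D₀) (fun a k => ξ a k ω) S) (S : ℕ) :
    weightAfter n o L (S + 1) *
        (∫ ω, P.objective (Y (S + 1) ω).xtilde - P.objective P.xstar ∂Pr) +
        ∫ ω, ‖(Y (S + 1) ω).x - P.xstar‖ ^ 2 / 2 ∂Pr ≤
      D₀ / (2 * o.const * L) + ∑ s ∈ Finset.range (S + 1),
        (D₀ / L * (((s + 1 : ℕ) : ℝ))⁻¹ +
          convexT n (s + 1) * (convexγ n o L (s + 1) * (3 * b * D))) := by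
  have hc3 := o.three_le_const
  have hstep : ∀ S : ℕ, weightAfter n o L (S + 1) *
        (∫ ω, P.objective (Y (S + 1) ω).xtilde - P.objective P.xstar ∂Pr) +
        ∫ ω, ‖(Y (S + 1) ω).x - P.xstar‖ ^ 2 / 2 ∂Pr ≤
      weightBefore n o L (S + 1) * (∫ ω, P.objective (Y S ω).xtilde - P.objective P.xstar ∂Pr) +
        (∫ ω, ‖(Y S ω).x - P.xstar‖ ^ 2 / 2 ∂Pr) + (D₀ / L * (((S + 1 : ℕ) : ℝ))⁻¹ +
          convexT n (S + 1) * (convexγ n o L (S + 1) * (3 * b * D))) := by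
    intro S
    have h := integral_arcs_succ_le hP hL hn hb (convexParams_regularEpoch hL hD₀) hξ S hY
    have hT : (convexT n (S + 1) : ℝ) ≠ 0 := by exact_mod_cast (convexT_pos n (S + 1)).ne'
    have e : (convexT n (S + 1) : ℝ) * (D₀ / (((S + 1 : ℕ) : ℝ) * convexT n (S + 1) * L)) =
        D₀ / L * (((S + 1 : ℕ) : ℝ))⁻¹ := by
      field_simp
    rw [← e, ← mul_add]
    exact h
  induction S with
  | zero =>
    have h := hstep 0
    rw [zero_add, weightBefore_one hL] at h
    refine h.trans (le_of_eq ?_)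
    rw [Finset.sum_range_one]
    congr 1
    have h0 : ∀ ω, Y 0 ω = ⟨P.x₀, P.x₀, 0, 0⟩ := by intro ω; rw [hY]; rfl
    simp only [h0, integral_const, probReal_univ, one_smul]
    rw [← hPD, Problem.dZero]
    field_simp
    ring
  | succ S ih =>
    have h := hstep (S + 1)
    rw [Finset.sum_range_succ]
    have hφ : 0 ≤ ∫ ω, P.objective (Y (S + 1) ω).xtilde - P.objective P.xstar ∂Pr := by
      refine integral_nonneg fun ω => ?_
      rw [hY]
      exact sub_objective_nonneg hP hL hD₀ _ _
    have := mul_le_mul_of_nonneg_right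
      (weightBefore_succ_le (n := n) (o := o) hL (Nat.succ_pos S)) hφ
    linarith

/-- The convergence rate, when the bias of the gradient estimates is small enough. -/
lemma integral_arcs_le (hP : P.Admissible L D) (hL : 0 < L) (hD₀ : 0 < D₀) (hn : 0 < n)
    (hb : GradErrorLE P o b) (hb0 : 0 ≤ b) (hξ : IsUniformSampling Pr ξ) (hPD : P.dZero o L = D₀)
    {S : ℕ} (hS : 0 < S) (hbS : b * (S * (n * ((S + 4) * (|D| + 1)))) ≤ D₀) :
    (∫ ω, P.objective (arcs P o (convexParams n o L D₀) (fun a k => ξ a k ω) S).xtilde -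
      P.objective P.xstar ∂Pr) ≤ 40 * D₀ * (2 + Real.log S) / rateWeight n S := by
  have hc3 := o.three_le_const
  have hc5 := o.const_le_five
  obtain ⟨S, rfl⟩ : ∃ S', S = S' + 1 := ⟨S - 1, by omega⟩
  have hT := convexT_pos n (S + 1)
  have hW : 0 < rateWeight n (S + 1) := by rw [rateWeight]; positivity
  have h1 := weightAfter_mul_integral_le hP hL hD₀ hn hb hξ hPD rfl S
  set φ : ℝ := ∫ ω, P.objective (arcs P o (convexParams n o L D₀) (fun a k => ξ a k ω)
    (S + 1)).xtilde - P.objective P.xstar ∂Pr with hφdef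
  have hφ : 0 ≤ φ := integral_nonneg fun ω => sub_objective_nonneg hP hL hD₀ _ _
  have hq : 0 ≤ ∫ ω, ‖(arcs P o (convexParams n o L D₀) (fun a k => ξ a k ω) (S + 1)).x -
    P.xstar‖ ^ 2 / 2 ∂Pr := integral_nonneg fun ω => by positivity
  have hH : ∑ s ∈ Finset.range (S + 1), (((s + 1 : ℕ) : ℝ))⁻¹ ≤ 1 + Real.log (S + 1 : ℕ) := by
    have := harmonic_le_one_add_log (S + 1)
    rw [harmonic] at this
    push_cast at this ⊢
    exact this
  have hbias : ∀ s ∈ Finset.range (S + 1),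
      convexT n (s + 1) * (convexγ n o L (s + 1) * (3 * b * D)) ≤
        n * (((S + 1 : ℕ) + 4) / (2 * L) * (b * (|D| + 1))) := by
    intro s hs
    have hγ : convexγ n o L (s + 1) * 3 ≤ ((S + 1 : ℕ) + 4) / (2 * L) := by
      have e : convexγ n o L (s + 1) = (((s + 1 - sZero n : ℕ) : ℝ) + 4) / (2 * (o.const * L)) := by
        rw [convexγ, convexα_eq]; field_simp
      have hk : ((s + 1 - sZero n : ℕ) : ℝ) ≤ ((S + 1 : ℕ) : ℝ) := by
        have := Finset.mem_range.1 hs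
        exact_mod_cast (by omega : s + 1 - sZero n ≤ S + 1)
      rw [e, div_mul_eq_mul_div, div_le_div_iff₀ (by positivity) (by positivity)]
      have : (((s + 1 - sZero n : ℕ) : ℝ) + 4) * 3 ≤ ((S + 1 : ℕ) + 4) * o.const :=
        mul_le_mul (by linarith) hc3 (by norm_num) (by positivity)
      nlinarith
    have hγ0 : 0 ≤ convexγ n o L (s + 1) := by
      rw [convexγ, convexα_eq]; positivity
    have hTn : (convexT n (s + 1) : ℝ) ≤ n := by exact_mod_cast convexT_le hn (s + 1)
    have hD : b * D ≤ b * (|D| + 1) := by gcongr; linarith [le_abs_self D]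
    calc convexT n (s + 1) * (convexγ n o L (s + 1) * (3 * b * D))
        = convexT n (s + 1) * (convexγ n o L (s + 1) * 3 * (b * D)) := by ring
      _ ≤ convexT n (s + 1) * (convexγ n o L (s + 1) * 3 * (b * (|D| + 1))) := by gcongr
      _ ≤ _ := by gcongr
  rw [Finset.sum_add_distrib, ← Finset.mul_sum] at h1
  have hbias2 := Finset.sum_le_sum hbias
  rw [Finset.sum_const, Finset.card_range, nsmul_eq_mul] at hbias2
  have hbias3 : ((S + 1 : ℕ) : ℝ) * (n * (((S + 1 : ℕ) + 4) / (2 * L) * (b * (|D| + 1)))) ≤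
      D₀ / (2 * L) := by
    have e : ((S + 1 : ℕ) : ℝ) * (n * (((S + 1 : ℕ) + 4) / (2 * L) * (b * (|D| + 1)))) =
        b * ((S + 1 : ℕ) * (n * (((S + 1 : ℕ) + 4) * (|D| + 1)))) / (2 * L) := by ring
    rw [e]
    gcongr
  have hH2 : D₀ / L * ∑ s ∈ Finset.range (S + 1), (((s + 1 : ℕ) : ℝ))⁻¹ ≤
      D₀ / L * (1 + Real.log (S + 1 : ℕ)) := by gcongr
  have h6 : D₀ / (2 * o.const * L) ≤ D₀ / (2 * L) := by
    gcongr; nlinarith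
  have h7 : D₀ / (2 * L) + D₀ / (2 * L) = D₀ / L := by ring
  have h2 : rateWeight n (S + 1) / (8 * o.const * L) * φ ≤
      D₀ / L * (2 + Real.log (S + 1 : ℕ)) := by
    have := mul_le_mul_of_nonneg_right
      (rateWeight_le_weightAfter (n := n) (o := o) hL (S + 1)) hφ
    linarith
  rw [div_mul_eq_mul_div, div_le_iff₀ (by positivity)] at h2
  rw [le_div_iff₀ hW]
  have e : D₀ / L * (2 + Real.log (S + 1 : ℕ)) * (8 * o.const * L) =
      o.const * (8 * (D₀ * (2 + Real.log (S + 1 : ℕ)))) := by field_simp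
  have h3 : o.const * (8 * (D₀ * (2 + Real.log (S + 1 : ℕ)))) ≤
      5 * (8 * (D₀ * (2 + Real.log (S + 1 : ℕ)))) := by gcongr
  linarith

/-! ### Query and oracle counts -/

lemma innerRun_queries {A : ARCSParams} {s : ℕ} {z : ℕ → Fin n} {σ : EpochState d} (t : ℕ) :
    (innerRun P o A s z σ t).queries = σ.queries + n * o.queries d + t * (2 * o.queries d) := by
  induction t with
  | zero => simp [innerRun]
  | succ t ih => rw [innerRun, innerStep, ih]; ring

lemma arcs_queries_le (hn : 0 < n) (z : ℕ → ℕ → Fin n) (S : ℕ) :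
    (arcs P o (convexParams n o L D₀) z S).queries ≤ S * (3 * n * o.queries d) := by
  induction S with
  | zero => simp [arcs]
  | succ S ih =>
    have hT : (convexParams n o L D₀).T (S + 1) ≤ n := convexT_le hn (S + 1)
    rw [arcs, epoch, innerRun_queries]
    have := Nat.mul_le_mul_right (2 * o.queries d) hT
    linarith

lemma innerRun_loCalls_le {A : ARCSParams} (hP : P.Admissible L D) {s : ℕ}
    (hA : A.RegularEpoch o L s)
    {z : ℕ → Fin n} {σ : EpochState d} (hx : σ.x ∈ P.C) (hxt : σ.xtilde ∈ P.C) (t : ℕ) :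
    ∃ c : ℕ, (innerRun P o A s z σ t).loCalls = σ.loCalls + c ∧
      (c : ℝ) ≤ t * (4 + 4 * ((|D| + 1) ^ 2 / A.η s 0)) := by
  induction t with
  | zero => exact ⟨0, by simp [innerRun], by simp⟩
  | succ t ih =>
    obtain ⟨c, hc, hle⟩ := ih
    obtain ⟨c', hc', hle'⟩ := innerStep_calls_le (t := t + 1) (xt := σ.xtilde)
      (gt := fullGrad P o σ.xtilde) hP hA.toRegular
      (innerRun_mem (z := z) hP hA.toRegular hx hxt t).1 (z (t + 1))
    refine ⟨c + c', ?_, ?_⟩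
    · rw [innerRun, hc', hc]; push_cast; ring
    · rw [hA.η_const] at hle'
      push_cast; linarith

lemma arcs_loCalls_le (hP : P.Admissible L D) (hL : 0 < L) (hD₀ : 0 < D₀) (z : ℕ → ℕ → Fin n)
    (S : ℕ) : ∃ c : ℕ, (arcs P o (convexParams n o L D₀) z S).loCalls = c ∧
      (c : ℝ) ≤ 4 * (1 + (|D| + 1) ^ 2 * L / D₀) *
        ∑ s ∈ Finset.range S, ((s + 1 : ℕ) : ℝ) * (convexT n (s + 1) : ℝ) ^ 2 := by
  induction S with
  | zero => exact ⟨0, by simp [arcs], by simp⟩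
  | succ S ih =>
    obtain ⟨c, hc, hle⟩ := ih
    have hmem := arcs_mem hP hL (convexParams_regularEpoch (n := n) (o := o) hL hD₀) z S
    obtain ⟨c', hc', hle'⟩ := innerRun_loCalls_le (z := z (S + 1)) hP
      (convexParams_regularEpoch (n := n) (o := o) hL hD₀ S) hmem.1 hmem.2
      ((convexParams n o L D₀).T (S + 1))
    refine ⟨c + c', ?_, ?_⟩
    · rw [arcs, epoch, hc', hc]; push_cast; ring
    · rw [Finset.sum_range_succ, mul_add]
      push_cast at hle ⊢
      refine add_le_add hle (hle'.trans ?_)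
      have hT1 : (1 : ℝ) ≤ convexT n (S + 1) := by exact_mod_cast convexT_pos n (S + 1)
      have hη : (convexParams n o L D₀).η (S + 1) 0 =
        D₀ / (((S + 1 : ℕ) : ℝ) * convexT n (S + 1) * L) := rfl
      have hT : (convexParams n o L D₀).T (S + 1) = convexT n (S + 1) := rfl
      rw [hη, hT]
      set T : ℝ := ((convexT n (S + 1) : ℕ) : ℝ)
      have e : (|D| + 1) ^ 2 / (D₀ / (((S + 1 : ℕ) : ℝ) * T * L)) =
          (|D| + 1) ^ 2 * L / D₀ * ((S + 1) * T) := by push_cast; field_simp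
      rw [e]
      have h1 : 1 ≤ ((S : ℝ) + 1) * T := by
        have : (0 : ℝ) ≤ S := Nat.cast_nonneg S
        nlinarith
      have h2 : 4 + 4 * ((|D| + 1) ^ 2 * L / D₀ * ((S + 1) * T)) ≤
          4 * (1 + (|D| + 1) ^ 2 * L / D₀) * ((S + 1) * T) := by linarith
      have h3 := mul_le_mul_of_nonneg_left h2 (by linarith : 0 ≤ T)
      linarith

end ConvexParams

/-! ### The number of epochs -/

section Epochs

variable {n : ℕ}

lemma convexT_succ_of_lt {s : ℕ} (hs : 0 < s) (h : s < sZero n) :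
    convexT n (s + 1) = 2 * convexT n s := by
  rw [convexT_eq, convexT_eq, min_eq_left h.le, min_eq_left (by omega : s + 1 ≤ sZero n),
    ← pow_succ']
  congr 1; omega

lemma convexT_succ_of_ge {s : ℕ} (h : sZero n ≤ s) : convexT n (s + 1) = convexT n s := by
  rw [convexT_eq, convexT_eq, min_eq_right h, min_eq_right (by omega : sZero n ≤ s + 1)]

lemma convexT_one (n : ℕ) : convexT n 1 = 1 := by
  rw [convexT_eq, min_eq_left (one_le_sZero n)]; norm_num

lemma rateWeight_one (n : ℕ) : rateWeight n 1 = 16 := by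
  have e1 : 1 - sZero n = 0 := by have := one_le_sZero n; omega
  rw [rateWeight, convexT_one, e1]; norm_num

lemma rateWeight_succ_le {s : ℕ} (hs : 0 < s) : rateWeight n (s + 1) ≤ 2 * rateWeight n s := by
  rw [rateWeight, rateWeight]
  rcases Nat.lt_or_ge s (sZero n) with h | h
  · have e1 : s + 1 - sZero n = 0 := by omega
    have e2 : s - sZero n = 0 := by omega
    rw [convexT_succ_of_lt hs h, e1, e2]
    push_cast
    exact le_of_eq (by ring)
  · have e1 : s + 1 - sZero n = (s - sZero n) + 1 := by omega
    rw [convexT_succ_of_ge h, e1]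
    push_cast
    set k : ℝ := ((s - sZero n : ℕ) : ℝ)
    have hk : 0 ≤ k := Nat.cast_nonneg _
    have h1 : (k + 1 + 4) ^ 2 ≤ 2 * (k + 4) ^ 2 := by nlinarith
    have := mul_le_mul_of_nonneg_left h1 (Nat.cast_nonneg (convexT n s) : (0 : ℝ) ≤ _)
    linarith

lemma sq_le_eight_mul_two_pow (m : ℕ) : m ^ 2 ≤ 8 * 2 ^ m := by
  induction m with
  | zero => norm_num
  | succ m ih =>
    have : m < 2 ^ m := Nat.lt_two_pow_self
    rw [pow_succ 2 m]
    nlinarith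

lemma sq_le_rateWeight (n S : ℕ) : (S : ℝ) ^ 2 ≤ rateWeight n S := by
  rw [rateWeight, convexT_eq]
  set m := min S (sZero n) with hm
  set k := S - sZero n with hk
  have hS : S = m + k := by omega
  have h1 : m < 2 ^ m := Nat.lt_two_pow_self
  have h2 := sq_le_eight_mul_two_pow m
  have h3 : 2 ^ m ≤ 2 * 2 ^ (m - 1) := by
    rw [← pow_succ']; exact Nat.pow_le_pow_right (by norm_num) (by omega)
  have h4 : 1 ≤ 2 ^ (m - 1) := Nat.one_le_two_pow
  have key : S ^ 2 ≤ 2 ^ (m - 1) * (k + 4) ^ 2 := by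
    rw [hS]
    set T := 2 ^ (m - 1)
    have a2 : 1 * k ^ 2 ≤ T * k ^ 2 := Nat.mul_le_mul_right _ h4
    nlinarith
  exact_mod_cast key

/-- The number of epochs is the first one at which the rate reaches the target accuracy `1 / r`;
by minimality the weight there is of the order of `r * log S`. -/
lemma exists_rateWeight_between (n : ℕ) {r : ℝ} (hr : 4 < r) :
    ∃ S : ℕ, 0 < S ∧ 40 * r * (2 + Real.log S) ≤ rateWeight n S ∧
      rateWeight n S ≤ 80 * r * (2 + Real.log S) := by
  classical
  have hex : ∃ S : ℕ, 0 < S ∧ 40 * r * (2 + Real.log S) ≤ rateWeight n S := by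
    obtain ⟨S, hS⟩ := exists_nat_ge (120 * r)
    refine ⟨S, by exact_mod_cast (by linarith : (0 : ℝ) < S), le_trans ?_ (sq_le_rateWeight n S)⟩
    have h1 : Real.log S ≤ S - 1 := Real.log_le_sub_one_of_pos (by linarith)
    have h2 : 40 * r * (2 + Real.log S) ≤ 40 * r * (3 * S) := by gcongr; linarith
    nlinarith
  obtain ⟨hS, hle⟩ := Nat.find_spec hex
  refine ⟨Nat.find hex, hS, hle, ?_⟩
  rcases Nat.lt_or_ge 1 (Nat.find hex) with h | h
  · obtain ⟨s, hs⟩ : ∃ s, Nat.find hex = s + 1 := ⟨Nat.find hex - 1, by omega⟩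
    have hmin := Nat.find_min hex (m := s) (by omega)
    have hs0 : 0 < s := by omega
    have h1 : rateWeight n s < 40 * r * (2 + Real.log s) := by
      by_contra! hcon
      exact hmin ⟨hs0, hcon⟩
    rw [hs]
    have h2 := rateWeight_succ_le (n := n) hs0
    have h3 : Real.log s ≤ Real.log (s + 1 : ℕ) :=
      Real.log_le_log (by exact_mod_cast hs0) (by push_cast; linarith)
    have h4 : 40 * r * (2 + Real.log s) ≤ 40 * r * (2 + Real.log (s + 1 : ℕ)) := by gcongr
    linarith
  · have e : Nat.find hex = 1 := by omega
    rw [e, rateWeight_one]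
    simp; linarith

/-- The sum that governs the number of linear oracle calls, in terms of the last epoch. -/
lemma sum_mul_convexT_sq_le (n S : ℕ) :
    ∑ s ∈ Finset.range S, ((s + 1 : ℕ) : ℝ) * (convexT n (s + 1) : ℝ) ^ 2 ≤
      (convexT n S : ℝ) ^ 2 * (2 * (min S (sZero n) : ℕ) +
        (S - sZero n : ℕ) * (min S (sZero n) : ℕ) + ((S - sZero n : ℕ) : ℝ) ^ 2) := by
  induction S with
  | zero => simp
  | succ S ih =>
    rw [Finset.sum_range_succ]
    rcases Nat.eq_zero_or_pos S with rfl | hS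
    · have h1 := one_le_sZero n
      have e1 : 1 - sZero n = 0 := by omega
      rw [zero_add, convexT_one, e1, min_eq_left h1]
      norm_num
    rcases Nat.lt_or_ge S (sZero n) with h | h
    · have e1 : S + 1 - sZero n = 0 := by omega
      have e2 : S - sZero n = 0 := by omega
      rw [e2, min_eq_left h.le] at ih
      rw [convexT_succ_of_lt hS h, e1, min_eq_left (by omega : S + 1 ≤ sZero n)]
      push_cast at ih ⊢
      nlinarith [sq_nonneg (convexT n S : ℝ)]
    · have e1 : S + 1 - sZero n = (S - sZero n) + 1 := by omega
      have e3 : S = sZero n + (S - sZero n) := by omega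
      rw [min_eq_right h] at ih
      rw [convexT_succ_of_ge h, e1, min_eq_right (by omega : sZero n ≤ S + 1)]
      set k := S - sZero n with hk
      have e4 : (S : ℝ) = sZero n + k := by exact_mod_cast e3
      push_cast at ih ⊢
      rw [e4] at *
      have : 0 ≤ (convexT n S : ℝ) ^ 2 * k := by positivity
      nlinarith

/-- The epochs split into `m` epochs of doubling length and `k` epochs of constant length. -/
lemma epochs_bounds {r : ℝ} (hr : 4 < r) {S : ℕ} (hS : 0 < S)
    (hW : rateWeight n S ≤ 80 * r * (2 + Real.log S)) :
    2 + Real.log S ≤ 8 * (1 + Real.log r) ∧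
    ((min S (sZero n) : ℕ) : ℝ) ≤ 9 * (1 + Real.log r) ∧
    ((S - sZero n : ℕ) : ℝ) ^ 2 * n ≤ 1280 * r * (1 + Real.log r) := by
  have hS1 : (1 : ℝ) ≤ S := by exact_mod_cast hS
  have hl1 : 1 ≤ Real.log r := by
    rw [Real.le_log_iff_exp_le (by linarith)]
    linarith [Real.exp_one_lt_d9]
  have hV : 2 + Real.log S ≤ 8 * (1 + Real.log r) := by
    have h1 : (S : ℝ) ^ 2 ≤ 240 * r * S := by
      have h2 := sq_le_rateWeight n S
      have h3 : Real.log S ≤ S - 1 := Real.log_le_sub_one_of_pos (by linarith)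
      have h4 : 80 * r * (2 + Real.log S) ≤ 80 * r * (3 * S) := by gcongr; linarith
      linarith
    have h2 : (S : ℝ) ≤ 240 * r := by
      rw [pow_two] at h1; exact le_of_mul_le_mul_right h1 (by linarith)
    have h3 : Real.log S ≤ Real.log (240 * r) := Real.log_le_log (by linarith) h2
    rw [Real.log_mul (by norm_num) (by linarith)] at h3
    have h4 : Real.log 240 ≤ 6 := by
      rw [Real.log_le_iff_le_exp (by norm_num)]
      have : Real.exp 6 = Real.exp 1 ^ 6 := by rw [← Real.exp_nat_mul]; norm_num
      rw [this]
      calc (240 : ℝ) ≤ 2.7 ^ 6 := by norm_num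
        _ ≤ _ := by gcongr; linarith [Real.exp_one_gt_d9]
    linarith
  refine ⟨hV, ?_, ?_⟩
  · have h1 : (convexT n S : ℝ) ≤ 40 * r * (1 + Real.log r) := by
      have h2 : (convexT n S : ℝ) * 16 ≤ rateWeight n S := by
        rw [rateWeight]
        gcongr
        nlinarith [(Nat.cast_nonneg (S - sZero n) : (0 : ℝ) ≤ _)]
      have h3 : 80 * r * (2 + Real.log S) ≤ 80 * r * (8 * (1 + Real.log r)) := by gcongr
      linarith
    rw [convexT_eq] at h1
    set m := min S (sZero n) with hm
    have h2 : Real.log ((2 ^ (m - 1) : ℕ) : ℝ) ≤ Real.log (40 * r * (1 + Real.log r)) :=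
      Real.log_le_log (by positivity) h1
    rw [Real.log_mul (by positivity) (by positivity), Real.log_mul (by norm_num) (by positivity)]
      at h2
    push_cast at h2
    rw [Real.log_pow] at h2
    have h3 : Real.log (1 + Real.log r) ≤ Real.log r := by
      have := Real.log_le_sub_one_of_pos (by linarith : 0 < 1 + Real.log r)
      linarith
    have h4 : Real.log 40 ≤ 4 := by
      rw [Real.log_le_iff_le_exp (by norm_num)]
      have : Real.exp 4 = Real.exp 1 ^ 4 := by rw [← Real.exp_nat_mul]; norm_num
      rw [this]
      calc (40 : ℝ) ≤ 2.7 ^ 4 := by norm_num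
        _ ≤ _ := by gcongr; linarith [Real.exp_one_gt_d9]
    have h5 : (m : ℝ) ≤ ((m - 1 : ℕ) : ℝ) + 1 := by exact_mod_cast (by omega : m ≤ m - 1 + 1)
    have h6 : ((m - 1 : ℕ) : ℝ) * (1 / 2) ≤ ((m - 1 : ℕ) : ℝ) * Real.log 2 := by
      gcongr; linarith [Real.log_two_gt_d9]
    linarith
  · rcases Nat.eq_zero_or_pos (S - sZero n) with h | h
    · rw [h]; push_cast; simp; positivity
    · have h1 : (n : ℝ) ≤ 2 * convexT n S := by
        have : n < 2 ^ (Nat.log 2 n + 1) := Nat.lt_pow_succ_log_self (by norm_num) n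
        have e : convexT n S = 2 ^ Nat.log 2 n := by
          rw [convexT_eq, min_eq_right (by omega)]; rfl
        rw [e]
        rw [pow_succ'] at this
        exact_mod_cast this.le
      set k : ℝ := ((S - sZero n : ℕ) : ℝ)
      have h3 : 80 * r * (2 + Real.log S) ≤ 80 * r * (8 * (1 + Real.log r)) := by gcongr
      have h4 : k ^ 2 * n ≤ k ^ 2 * (2 * convexT n S) := by gcongr
      have h5 : convexT n S * k ^ 2 ≤ rateWeight n S := by
        rw [rateWeight]; gcongr; linarith
      linarith

lemma epoch_sum_le_of_weight {T k m W : ℝ} (hk : 0 ≤ k) (hm : 1 ≤ m)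
    (hW : W = T * (k + 4) ^ 2) : T ^ 2 * (2 * m + k * m + k ^ 2) ≤ W ^ 2 * m := by
  have h1 : 2 * m + k * m + k ^ 2 ≤ (k + 4) ^ 2 * m := by nlinarith
  have h2 : (k + 4) ^ 2 * m ≤ (k + 4) ^ 4 * m := by
    have : (1 : ℝ) ≤ k + 4 := by linarith
    gcongr
    norm_num
  calc T ^ 2 * (2 * m + k * m + k ^ 2) ≤ T ^ 2 * ((k + 4) ^ 4 * m) := by
        have := h1.trans h2
        gcongr
    _ = W ^ 2 * m := by rw [hW]; ring

lemma epoch_sum_le_of_length {T k m N r Λ : ℝ} (hT : 0 ≤ T) (hTN : T ≤ N) (hr : 0 ≤ r)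
    (hΛ : 1 ≤ Λ) (hm0 : 0 ≤ m) (hm : m ≤ 9 * Λ) (hk : k ^ 2 * N ≤ 1280 * r * Λ) :
    T ^ 2 * (2 * m + k * m + k ^ 2) ≤ 2100000 * Λ ^ 2 * (N ^ 2 + N * r) := by
  have hN : 0 ≤ N := hT.trans hTN
  have hΛ2 : Λ ≤ Λ ^ 2 := le_self_pow₀ hΛ two_ne_zero
  have h1 : T ^ 2 * k ^ 2 ≤ 1280 * (N * r * Λ ^ 2) := by
    calc T ^ 2 * k ^ 2 ≤ N ^ 2 * k ^ 2 := by gcongr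
      _ = N * (k ^ 2 * N) := by ring
      _ ≤ N * (1280 * r * Λ ^ 2) := mul_le_mul_of_nonneg_left (hk.trans (by gcongr)) hN
      _ = _ := by ring
  have h2 : T ^ 2 * m ≤ N ^ 2 * (9 * Λ ^ 2) := by
    have := hm.trans (mul_le_mul_of_nonneg_left hΛ2 (by norm_num : (0 : ℝ) ≤ 9))
    gcongr
  have h3 : T ^ 2 * m ^ 2 ≤ N ^ 2 * (9 * Λ) ^ 2 := by gcongr
  have h4 : T ^ 2 * (k * m) ≤ T ^ 2 * ((k ^ 2 + m ^ 2) / 2) := by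
    refine mul_le_mul_of_nonneg_left ?_ (by positivity)
    linarith [two_mul_le_add_sq k m]
  have h5 : 0 ≤ N * r * Λ ^ 2 := by positivity
  have h6 : 0 ≤ N ^ 2 * Λ ^ 2 := by positivity
  linarith

/-- The number of epochs for the target accuracy `1 / r` (relative to the initial error), and the
two sums that bound the query and oracle counts. For `r ≤ n` the run barely leaves the regime of
doubling epoch lengths; for `n < r` the bounds rest on all lengths being at most `n`. -/
lemma exists_epochs (hn : 0 < n) {r : ℝ} (hr : 4 < r) :
    ∃ S : ℕ, 0 < S ∧ 40 * r * (2 + Real.log S) ≤ rateWeight n S ∧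
      (r ≤ n → (S : ℝ) ≤ 45 * (1 + Real.log r) ∧
        ∑ s ∈ Finset.range S, ((s + 1 : ℕ) : ℝ) * (convexT n (s + 1) : ℝ) ^ 2 ≤
          2100000 * (1 + Real.log r) ^ 2 * r ^ 2) ∧
      ((n : ℝ) < r → n * (S : ℝ) ≤ 45 * (1 + Real.log r) * Real.sqrt (n * r) ∧
        ∑ s ∈ Finset.range S, ((s + 1 : ℕ) : ℝ) * (convexT n (s + 1) : ℝ) ^ 2 ≤
          2100000 * (1 + Real.log r) ^ 2 * ((n : ℝ) ^ 2 + n * r)) := by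
  obtain ⟨S, hS, hW1, hW2⟩ := exists_rateWeight_between n hr
  refine ⟨S, hS, hW1, ?_⟩
  obtain ⟨hV, hm, hk⟩ := epochs_bounds hr hS hW2
  have hQ := sum_mul_convexT_sq_le n S
  have hl1 : 1 ≤ Real.log r := by
    rw [Real.le_log_iff_exp_le (by linarith)]
    linarith [Real.exp_one_lt_d9]
  have hSmk : (S : ℝ) = ((min S (sZero n) : ℕ) : ℝ) + ((S - sZero n : ℕ) : ℝ) := by
    exact_mod_cast (by omega : S = min S (sZero n) + (S - sZero n))
  have hm1 : (1 : ℝ) ≤ ((min S (sZero n) : ℕ) : ℝ) := by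
    have := one_le_sZero n
    exact_mod_cast (by omega : 1 ≤ min S (sZero n))
  have hTn : (convexT n S : ℝ) ≤ n := by exact_mod_cast convexT_le hn S
  have hn1 : (1 : ℝ) ≤ n := by exact_mod_cast hn
  have hWdef : rateWeight n S = convexT n S * (((S - sZero n : ℕ) : ℝ) + 4) ^ 2 := rfl
  set m : ℝ := ((min S (sZero n) : ℕ) : ℝ)
  set k : ℝ := ((S - sZero n : ℕ) : ℝ) with hkdef
  have hk0 : 0 ≤ k := Nat.cast_nonneg _
  set T : ℝ := ((convexT n S : ℕ) : ℝ) with hT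
  have hT0 : 0 ≤ T := Nat.cast_nonneg _
  set Λ : ℝ := 1 + Real.log r with hΛ
  constructor
  · intro hrn
    have hk2 : k ≤ 36 * Λ := by
      have h1 : k ^ 2 * n ≤ (1280 * Λ) * n := by nlinarith
      have h2 : k ^ 2 ≤ 1280 * Λ := le_of_mul_le_mul_right h1 (by linarith)
      exact abs_le_of_sq_le_sq' (by nlinarith) (by linarith) |>.2
    have hS45 : (S : ℝ) ≤ 45 * Λ := by linarith
    refine ⟨hS45, ?_⟩
    -- with `S = O(Λ)` the factor `2 + log S` is even `O(√Λ)`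
    have hV2 : (2 + Real.log S) ^ 2 ≤ 36 * Λ := by
      have h1 : Real.log S ≤ Real.log (45 * Λ) := Real.log_le_log (by linarith) hS45
      rw [Real.log_mul (by norm_num) (by linarith)] at h1
      have h2 : Real.log 45 ≤ 4 := by
        rw [Real.log_le_iff_le_exp (by norm_num)]
        have : Real.exp 4 = Real.exp 1 ^ 4 := by rw [← Real.exp_nat_mul]; norm_num
        rw [this]
        calc (45 : ℝ) ≤ 2.7 ^ 4 := by norm_num
          _ ≤ _ := by gcongr; linarith [Real.exp_one_gt_d9]
      have hsq : Real.sqrt Λ ^ 2 = Λ := Real.sq_sqrt (by linarith)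
      have hs1 : 1 ≤ Real.sqrt Λ := by
        rw [Real.le_sqrt' one_pos]; linarith
      have h3 : Real.log Λ ≤ 2 * (Real.sqrt Λ - 1) := by
        have h4 := Real.log_le_sub_one_of_pos (by linarith : 0 < Real.sqrt Λ)
        rw [Real.log_sqrt (by linarith)] at h4
        linarith
      have h4 : 2 + Real.log S ≤ 6 * Real.sqrt Λ := by linarith
      calc (2 + Real.log S) ^ 2 ≤ (6 * Real.sqrt Λ) ^ 2 := by gcongr
        _ = 36 * Λ := by rw [mul_pow, hsq]; norm_num
    set W := rateWeight n S with hWW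
    have hW0 : 0 ≤ W := by rw [hWdef]; positivity
    have b1 := epoch_sum_le_of_weight hk0 hm1 hWdef
    have b2 : W ^ 2 ≤ (80 * r * (2 + Real.log S)) ^ 2 := by gcongr
    have b3 : (80 * r * (2 + Real.log S)) ^ 2 ≤ 6400 * r ^ 2 * (36 * Λ) := by
      have : (80 * r * (2 + Real.log S)) ^ 2 = 6400 * r ^ 2 * (2 + Real.log S) ^ 2 := by ring
      rw [this]; gcongr
    have b4 : W ^ 2 * m ≤ 6400 * r ^ 2 * (36 * Λ) * (9 * Λ) := by
      have := b2.trans b3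
      gcongr
    have b5 : 0 ≤ Λ ^ 2 * r ^ 2 := by positivity
    linarith
  · intro hnr
    have hsq : Real.sqrt (n * r) ^ 2 = n * r := Real.sq_sqrt (by positivity)
    have hs0 := Real.sqrt_nonneg ((n : ℝ) * r)
    have h1 : (n : ℝ) ≤ Real.sqrt (n * r) := by
      rw [Real.le_sqrt' (by linarith), pow_two]; gcongr
    have h2 : n * k ≤ 36 * Λ * Real.sqrt (n * r) := by
      refine (abs_le_of_sq_le_sq' ?_ (by positivity)).2
      rw [mul_pow, mul_pow, hsq]
      have c1 : n * (k ^ 2 * n) ≤ n * (1280 * r * Λ) := by gcongr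
      have c2 : 0 ≤ n * r * Λ * (Λ - 1) := mul_nonneg (by positivity) (by linarith)
      have c3 : 0 ≤ n * r * Λ := by positivity
      nlinarith
    have h3 : n * m ≤ 9 * Λ * Real.sqrt (n * r) := by
      calc n * m ≤ Real.sqrt (n * r) * (9 * Λ) := by gcongr
        _ = _ := by ring
    refine ⟨by rw [hSmk]; linarith, hQ.trans ?_⟩
    exact epoch_sum_le_of_length hT0 hTn (by linarith) (by linarith) (by linarith) hm hk

end Epochs

/-! ### Complexity bounds -/

section Complexity

variable {n d : ℕ} {o : OracleModel} {L D D₀ b ε : ℝ} {P : Problem n d}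
  {Ω : Type*} [MeasurableSpace Ω] {Pr : Measure Ω} [IsProbabilityMeasure Pr]
  {ξ : ℕ → ℕ → Ω → Fin n}

lemma gradErrorLE_firstOrder (P : Problem n d) : GradErrorLE P .firstOrder 0 := fun i x => by
  simp [OracleModel.grad]

lemma Problem.Admissible.gradErrorLE_zerothOrder (hP : P.Admissible L D) {μ : ℝ} (hμ : 0 < μ) :
    GradErrorLE P (.zerothOrder μ) (d * (L * μ / 2)) := fun i x =>
  (hP.smooth_f i).norm_coordGrad_sub_gradient_le hμ x

lemma Problem.Admissible.sub_objective_start_le (hP : P.Admissible L D) (hL : 0 < L)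
    (hPD : P.dZero o L = D₀) : 0 ≤ D₀ ∧ P.objective P.x₀ - P.objective P.xstar ≤ D₀ / 4 := by
  have h1 := hP.xstar_min _ hP.x₀_mem
  have h2 : 0 ≤ o.const * L * ‖P.x₀ - P.xstar‖ ^ 2 := by
    have := o.three_le_const
    have : 0 ≤ o.const := by linarith
    positivity
  rw [← hPD, Problem.dZero]
  constructor <;> linarith

/-- For `D₀ / 4 ≤ ε` the starting point is accurate enough, and nothing has to be done. -/
lemma achievesAccuracy_zero (hP : P.Admissible L D) (hL : 0 < L) (hPD : P.dZero o L = D₀)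
    (hε : D₀ / 4 ≤ ε) : AchievesAccuracy P o L Pr ξ 0 ε := by
  have h := (hP.sub_objective_start_le hL hPD).2
  have e : ∀ ω, (convexARCS P o L (fun s t => ξ s t ω) 0).xtilde = P.x₀ := fun ω => rfl
  simp only [AchievesAccuracy, e, integral_const, probReal_univ, one_smul]
  refine ⟨fun _ => hP.x₀_mem, integrable_const _, ?_⟩
  linarith

lemma achievesAccuracy_of_rateWeight (hP : P.Admissible L D) (hL : 0 < L) (hD₀ : 0 < D₀)
    (hε : 0 < ε) (hn : 0 < n) (hb : GradErrorLE P o b) (hb0 : 0 ≤ b)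
    (hξ : IsUniformSampling Pr ξ) (hPD : P.dZero o L = D₀)
    {S : ℕ} (hS : 0 < S) (hbS : b * (S * (n * ((S + 4) * (|D| + 1)))) ≤ D₀)
    (hW : 40 * (D₀ / ε) * (2 + Real.log S) ≤ rateWeight n S) :
    AchievesAccuracy P o L Pr ξ S ε := by
  have hW0 : 0 < rateWeight n S := by
    have := convexT_pos n S
    rw [rateWeight]; positivity
  simp only [AchievesAccuracy, convexARCS, hPD]
  refine ⟨fun ω => (arcs_mem hP hL (convexParams_regularEpoch hL hD₀) _ S).2,
    integrable_arcs hξ hn S fun s => P.objective s.xtilde - P.objective P.xstar,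
    (integral_arcs_le hP hL hD₀ hn hb hb0 hξ hPD hS hbS).trans ?_⟩
  rw [div_le_iff₀ hW0]
  have e : 40 * D₀ * (2 + Real.log S) = ε * (40 * (D₀ / ε) * (2 + Real.log S)) := by
    field_simp
  rw [e]
  gcongr

/-- The constant of the linear oracle complexity. -/
def loConst (L D D₀ : ℝ) : ℝ :=
  4 * (1 + (|D| + 1) ^ 2 * L / |D₀|) * 2100000 * (1 + |D₀|) ^ 2

lemma loConst_pos (hL : 0 < L) : 0 < loConst L D D₀ := by
  rw [loConst]; positivity

/-- The complexity bounds of a run, with `q` oracle queries per evaluation of a component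
gradient. -/
def ComplexityBounds (n : ℕ) (q : ℕ) (K M D₀ ε : ℝ) (queries : ℕ) (loCalls : ℕ∞) : Prop :=
  (D₀ / n ≤ ε →
    (queries : ℝ) ≤ K * logFactor D₀ ε * (n * q * Real.posLog (D₀ / ε)) ∧
    (loCalls : ℝ≥0∞) ≤ ENNReal.ofReal (M * logFactor D₀ ε ^ 2 * (1 / ε ^ 2))) ∧
  (queries : ℝ) ≤
    K * logFactor D₀ ε * (n * q * Real.log n + q * Real.sqrt (n * D₀ / ε)) ∧
  (loCalls : ℝ≥0∞) ≤ ENNReal.ofReal (M * logFactor D₀ ε ^ 2 * ((n : ℝ) ^ 2 + n / ε))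

lemma logFactor_pos (D₀ ε : ℝ) : 0 < logFactor D₀ ε := by
  have := Real.posLog_nonneg (x := D₀ / ε)
  rw [logFactor]; linarith

lemma complexityBounds_zero {q : ℕ} {K M : ℝ} (hK : 0 ≤ K) :
    ComplexityBounds n q K M D₀ ε 0 0 := by
  have h1 := logFactor_pos D₀ ε
  have h2 := Real.posLog_nonneg (x := D₀ / ε)
  have h3 : 0 ≤ Real.log n := Real.log_natCast_nonneg _
  refine ⟨fun _ => ⟨?_, by simp⟩, ?_, by simp⟩ <;> push_cast <;> positivity

/-- The arithmetic behind the complexity bounds: `S` is the number of epochs, `Q` the sum over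
the epochs that governs the linear oracle calls. -/
lemma complexityBounds_of_epochs {q S queries lo : ℕ} {Q : ℝ} (hL : 0 < L) (hD₀ : 0 < D₀)
    (hε : 0 < ε) (hn : 0 < n) (hr : 4 < D₀ / ε)
    (hqueries : queries ≤ S * (3 * n * q))
    (hlo : (lo : ℝ) ≤ 4 * (1 + (|D| + 1) ^ 2 * L / D₀) * Q)
    (hshort : D₀ / ε ≤ n → (S : ℝ) ≤ 45 * (1 + Real.log (D₀ / ε)) ∧
      Q ≤ 2100000 * (1 + Real.log (D₀ / ε)) ^ 2 * (D₀ / ε) ^ 2)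
    (hlong : (n : ℝ) < D₀ / ε →
      n * (S : ℝ) ≤ 45 * (1 + Real.log (D₀ / ε)) * Real.sqrt (n * (D₀ / ε)) ∧
      Q ≤ 2100000 * (1 + Real.log (D₀ / ε)) ^ 2 * ((n : ℝ) ^ 2 + n * (D₀ / ε))) :
    ComplexityBounds n q 135 (loConst L D D₀) D₀ ε queries lo := by
  have hl1 : 1 ≤ Real.log (D₀ / ε) := by
    rw [Real.le_log_iff_exp_le (by linarith)]
    linarith [Real.exp_one_lt_d9]
  have hpos : Real.posLog (D₀ / ε) = Real.log (D₀ / ε) :=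
    Real.posLog_eq_log (by rw [abs_of_pos (by linarith)]; linarith)
  have hΛ : logFactor D₀ ε = 1 + Real.log (D₀ / ε) := by rw [logFactor, hpos]
  have hn1 : (1 : ℝ) ≤ n := by exact_mod_cast hn
  have hnD : D₀ / n ≤ ε ↔ D₀ / ε ≤ n := by
    rw [div_le_iff₀ (by linarith), div_le_iff₀ hε, mul_comm]
  have hlogn : 0 ≤ Real.log n := Real.log_natCast_nonneg _
  have hqS : (queries : ℝ) ≤ 3 * q * (n * S) := by
    calc (queries : ℝ) ≤ ((S * (3 * n * q) : ℕ) : ℝ) := by exact_mod_cast hqueries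
      _ = _ := by push_cast; ring
  have hM : loConst L D D₀ = 4 * (1 + (|D| + 1) ^ 2 * L / D₀) * 2100000 * (1 + D₀) ^ 2 := by
    rw [loConst, abs_of_pos hD₀]
  have hsqrt : Real.sqrt (n * D₀ / ε) = Real.sqrt (n * (D₀ / ε)) := by rw [mul_div_assoc]
  have hcast : ((lo : ℕ∞) : ℝ≥0∞) = (lo : ℝ≥0∞) := by simp
  have hofReal : ∀ X : ℝ, (lo : ℝ) ≤ X → ((lo : ℕ∞) : ℝ≥0∞) ≤ ENNReal.ofReal X := by
    intro X hX
    rw [hcast, ← ENNReal.ofReal_natCast]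
    exact ENNReal.ofReal_le_ofReal hX
  rw [ComplexityBounds, hnD, hpos, hsqrt, hΛ, hM]
  set Λ := 1 + Real.log (D₀ / ε) with hΛdef
  set A := 4 * (1 + (|D| + 1) ^ 2 * L / D₀) with hA
  have hA0 : 0 < A := by positivity
  have hΛ0 : 0 < Λ := by linarith
  have hlo' : ∀ X, Q ≤ X → (lo : ℝ) ≤ A * X := fun X hX =>
    hlo.trans (mul_le_mul_of_nonneg_left hX hA0.le)
  have hD1 : D₀ ^ 2 ≤ (1 + D₀) ^ 2 := by gcongr; linarith
  have hD2 : (1 : ℝ) ≤ (1 + D₀) ^ 2 := one_le_pow₀ (by linarith)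
  have hD3 : D₀ ≤ (1 + D₀) ^ 2 := by nlinarith
  rcases le_or_gt (D₀ / ε) n with h | h
  · obtain ⟨hS, hQ⟩ := hshort h
    have h1 : (queries : ℝ) ≤ 135 * Λ * (n * q) := by
      calc (queries : ℝ) ≤ 3 * q * (n * S) := hqS
        _ ≤ 3 * q * (n * (45 * Λ)) := by gcongr
        _ = _ := by ring
    have hll : Real.log (D₀ / ε) ≤ Real.log n := Real.log_le_log (by linarith) h
    refine ⟨fun _ => ⟨h1.trans ?_, hofReal _ ((hlo' _ hQ).trans ?_)⟩, h1.trans ?_,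
      hofReal _ ((hlo' _ hQ).trans ?_)⟩
    · refine mul_le_mul_of_nonneg_left ?_ (by positivity)
      exact le_mul_of_one_le_right (by positivity) hl1
    · calc A * (2100000 * Λ ^ 2 * (D₀ / ε) ^ 2)
          = A * 2100000 * D₀ ^ 2 * Λ ^ 2 * (1 / ε ^ 2) := by ring
        _ ≤ _ := by gcongr
    · gcongr
      have h2 : (n : ℝ) * q ≤ n * q * Real.log n :=
        le_mul_of_one_le_right (by positivity) (hl1.trans hll)
      have h3 : 0 ≤ q * Real.sqrt (n * (D₀ / ε)) := by positivity
      linarith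
    · calc A * (2100000 * Λ ^ 2 * (D₀ / ε) ^ 2)
          ≤ A * (2100000 * Λ ^ 2 * (n : ℝ) ^ 2) := by gcongr
        _ = A * 2100000 * 1 * Λ ^ 2 * (n : ℝ) ^ 2 := by ring
        _ ≤ A * 2100000 * (1 + D₀) ^ 2 * Λ ^ 2 * ((n : ℝ) ^ 2 + n / ε) := by
            gcongr
            have : 0 ≤ n / ε := by positivity
            linarith
  · obtain ⟨hS, hQ⟩ := hlong h
    refine ⟨fun h' => absurd h' (not_le.2 h), ?_, hofReal _ ((hlo' _ hQ).trans ?_)⟩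
    · calc (queries : ℝ) ≤ 3 * q * (n * S) := hqS
        _ ≤ 3 * q * (45 * Λ * Real.sqrt (n * (D₀ / ε))) := by gcongr
        _ = 135 * Λ * (q * Real.sqrt (n * (D₀ / ε))) := by ring
        _ ≤ _ := by
            gcongr
            have : 0 ≤ n * q * Real.log n := by positivity
            linarith
    · have h4 : (n : ℝ) ^ 2 + n * (D₀ / ε) ≤ (1 + D₀) ^ 2 * ((n : ℝ) ^ 2 + n / ε) := by
        have a1 : 1 * (n : ℝ) ^ 2 ≤ (1 + D₀) ^ 2 * (n : ℝ) ^ 2 := by gcongr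
        have a2 : D₀ * (n / ε) ≤ (1 + D₀) ^ 2 * (n / ε) := by gcongr
        have a3 : (n : ℝ) * (D₀ / ε) = D₀ * (n / ε) := by ring
        linarith
      calc A * (2100000 * Λ ^ 2 * ((n : ℝ) ^ 2 + n * (D₀ / ε)))
          ≤ A * (2100000 * Λ ^ 2 * ((1 + D₀) ^ 2 * ((n : ℝ) ^ 2 + n / ε))) := by gcongr
        _ = _ := by ring

/-- Both cases at once: a number of epochs `S`, and a bias `b` of the gradient estimates that is
harmless for this number of epochs. -/
lemma exists_epochs_complexity (n : ℕ) (L D D₀ ε : ℝ) (hL : 0 < L) (hn : 0 < n) (hε : 0 < ε) :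
    ∃ S : ℕ, ∃ b₀ : ℝ, 0 < b₀ ∧ ∀ (d : ℕ) (o : OracleModel) (P : Problem n d) (b : ℝ),
      P.Admissible L D → P.dZero o L = D₀ → GradErrorLE P o b → 0 ≤ b → b ≤ b₀ →
      ∀ {Ω : Type*} [MeasurableSpace Ω] (Pr : Measure Ω) [IsProbabilityMeasure Pr]
        (ξ : ℕ → ℕ → Ω → Fin n), IsUniformSampling Pr ξ →
        AchievesAccuracy P o L Pr ξ S ε ∧
        ∀ ω, ComplexityBounds n (o.queries d) 135 (loConst L D D₀) D₀ ε
          (convexARCS P o L (fun s t => ξ s t ω) S).queries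
          (convexARCS P o L (fun s t => ξ s t ω) S).loCalls := by
  rcases le_or_gt (D₀ / 4) ε with h | h
  · refine ⟨0, 1, one_pos, fun d o P b hP hPD _ _ _ Ω _ Pr _ ξ _ =>
      ⟨achievesAccuracy_zero hP hL hPD h, fun ω => ?_⟩⟩
    exact complexityBounds_zero (by norm_num)
  · have hD₀ : 0 < D₀ := by linarith
    have hr : 4 < D₀ / ε := by rw [lt_div_iff₀ hε]; linarith
    obtain ⟨S, hS, hW, hshort, hlong⟩ := exists_epochs hn hr
    have hX : 0 < (S : ℝ) * (n * ((S + 4) * (|D| + 1))) := by positivity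
    refine ⟨S, D₀ / (S * (n * ((S + 4) * (|D| + 1)))), by positivity,
      fun d o P b hP hPD hb hb0 hbb Ω _ Pr _ ξ hξ => ⟨?_, fun ω => ?_⟩⟩
    · rw [le_div_iff₀ hX] at hbb
      exact achievesAccuracy_of_rateWeight hP hL hD₀ hε hn hb hb0 hξ hPD hS hbb hW
    · rw [convexARCS, hPD]
      obtain ⟨c, hc, hle⟩ := arcs_loCalls_le (o := o) hP hL hD₀ (fun s t => ξ s t ω) S
      rw [hc]
      exact complexityBounds_of_epochs hL hD₀ hε hn hr (arcs_queries_le hn _ S) hle hshort hlong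

end Complexity

end

theorem corollary1 :
    -- `K` is an absolute constant, `M` depends on `L`, `D`, `D₀` only
    ∃ K : ℝ, 0 < K ∧ ∀ L D D₀ : ℝ, 0 < L → ∃ M : ℝ, 0 < M ∧
    ∀ (n d : ℕ) (ε : ℝ), 0 < n → 0 < ε →
      -- first-order case
      (∃ S : ℕ,
        ∀ P : Problem n d, P.Admissible L D → P.dZero .firstOrder L = D₀ →
        ∀ {Ω : Type*} [MeasurableSpace Ω] (Pr : Measure Ω) [IsProbabilityMeasure Pr]
          (ξ : ℕ → ℕ → Ω → Fin n), IsUniformSampling Pr ξ →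
          AchievesAccuracy P .firstOrder L Pr ξ S ε ∧
          ∀ ω, let run := convexARCS P .firstOrder L (fun s t => ξ s t ω) S
            (D₀ / n ≤ ε →
              (run.queries : ℝ) ≤ K * logFactor D₀ ε * (n * Real.posLog (D₀ / ε)) ∧
              (run.loCalls : ℝ≥0∞) ≤ ENNReal.ofReal (M * logFactor D₀ ε ^ 2 * (1 / ε ^ 2))) ∧
            (run.queries : ℝ) ≤
              K * logFactor D₀ ε * (n * Real.log n + Real.sqrt (n * D₀ / ε)) ∧
            (run.loCalls : ℝ≥0∞) ≤
              ENNReal.ofReal (M * logFactor D₀ ε ^ 2 * ((n : ℝ) ^ 2 + n / ε))) ∧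
      -- zeroth-order case, with a sufficiently small smoothing parameter `μ`
      (∃ S : ℕ, ∃ μ₀ : ℝ, 0 < μ₀ ∧ ∀ μ : ℝ, 0 < μ → μ ≤ μ₀ →
        ∀ P : Problem n d, P.Admissible L D → P.dZero (.zerothOrder μ) L = D₀ →
        ∀ {Ω : Type*} [MeasurableSpace Ω] (Pr : Measure Ω) [IsProbabilityMeasure Pr]
          (ξ : ℕ → ℕ → Ω → Fin n), IsUniformSampling Pr ξ →
          AchievesAccuracy P (.zerothOrder μ) L Pr ξ S ε ∧
          ∀ ω, let run := convexARCS P (.zerothOrder μ) L (fun s t => ξ s t ω) S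
            (D₀ / n ≤ ε →
              (run.queries : ℝ) ≤ K * logFactor D₀ ε * (n * d * Real.posLog (D₀ / ε)) ∧
              (run.loCalls : ℝ≥0∞) ≤ ENNReal.ofReal (M * logFactor D₀ ε ^ 2 * (1 / ε ^ 2))) ∧
            (run.queries : ℝ) ≤
              K * logFactor D₀ ε * (n * d * Real.log n + d * Real.sqrt (n * D₀ / ε)) ∧
            (run.loCalls : ℝ≥0∞) ≤
              ENNReal.ofReal (M * logFactor D₀ ε ^ 2 * ((n : ℝ) ^ 2 + n / ε))) := by
  refine ⟨270, by norm_num, fun L D D₀ hL => ⟨loConst L D D₀, loConst_pos hL,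
    fun n d ε hn hε => ?_⟩⟩
  have hΛ := logFactor_pos D₀ ε
  have hlog : 0 ≤ Real.posLog (D₀ / ε) := Real.posLog_nonneg
  have hlogn : 0 ≤ Real.log n := Real.log_natCast_nonneg _
  constructor
  · obtain ⟨S, b₀, hb₀, hmain⟩ := exists_epochs_complexity n L D D₀ ε hL hn hε
    refine ⟨S, fun P hP hPD Ω _ Pr _ ξ hξ => ?_⟩
    obtain ⟨hacc, hbd⟩ := hmain d _ P 0 hP hPD (gradErrorLE_firstOrder P) le_rfl hb₀.le Pr ξ hξ
    refine ⟨hacc, fun ω => ?_⟩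
    obtain ⟨h1, h2, h3⟩ := hbd ω
    simp only [OracleModel.queries, Nat.cast_one, mul_one, one_mul] at h1 h2
    refine ⟨fun h => ⟨(h1 h).1.trans ?_, (h1 h).2⟩, h2.trans ?_, h3⟩ <;>
    · gcongr
      norm_num
  · obtain ⟨S, b₀, hb₀, hmain⟩ := exists_epochs_complexity n L D D₀ ε hL hn hε
    refine ⟨S, b₀ / (d * (L / 2) + 1), by positivity, fun μ hμ hμ₀ P hP hPD Ω _ Pr _ ξ hξ => ?_⟩
    have hb : d * (L * μ / 2) ≤ b₀ := by
      rw [le_div_iff₀ (by positivity)] at hμ₀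
      linarith
    obtain ⟨hacc, hbd⟩ := hmain d _ P _ hP hPD (hP.gradErrorLE_zerothOrder hμ) (by positivity) hb
      Pr ξ hξ
    refine ⟨hacc, fun ω => ?_⟩
    obtain ⟨h1, h2, h3⟩ := hbd ω
    simp only [OracleModel.queries, Nat.cast_mul, Nat.cast_ofNat] at h1 h2
    refine ⟨fun h => ⟨(h1 h).1.trans (le_of_eq ?_), (h1 h).2⟩, h2.trans (le_of_eq ?_), h3⟩ <;> ring
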